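/- For $\tau$ in the upper half plane $\mathcal H$ let $q=e^{2\pi i\tau}$, let $\eta$ be the Dedekind eta function, and for $z\in\mathbb C$ with $z\notin\frac{1+\tau}{2}+\mathbb Z+\tau\mathbb Z$ put $$\widetilde\wp(z,\tau)=\frac1{\pi^2}\sum_{(n,m)\in\mathbb Z^2}\left(\frac1{\bigl(z+(n+\frac12)+(m+\frac12)\tau\bigr)^2}-\frac1{\bigl((n+\frac12)+(m+\frac12)\tau\bigr)^2}\right).$$ Let $M_{w}(\Gamma_0(4))$ be the complex vector space of holomorphic modular forms of weight $w$ on $\Gamma_0(4)$, and put, for $\tau\in\mathcal H$, $$E(\tau)=\widetilde\wp(\tau,2\tau),\qquad \Delta_4(\tau)=\frac{\eta(4\tau)^8}{\eta(2\tau)^4}.$$ Then: 1. For all $\tau\in\mathcal H$, $E(\tau)=\eta(\tau)^8/\eta(2\tau)^4$ and $\Delta_4(\tau)=-\frac1{16}\widetilde\wp(\frac12,2\tau)$. Neither $E$ nor $\Delta_4$ vanishes anywhere on $\mathcal H$. 2. $(E,\Delta_4)$ is a basis of $M_2(\Gamma_0(4))$. 3. For every $k\ge 2$, $M_{2k}(\Gamma_0(4))=\mathrm{span}(E^k)\oplus\Delta_4\cdot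 M_{2k-2}(\Gamma_0(4))$. 4. For every $k\ge 1$, $M_{2k}(\Gamma_0(4))$ is exactly the set of functions $P(E,\Delta_4)$ with $P\in\mathbb C[X,Y]$ homogeneous of degree $k$, and the family $\bigl(E^a\Delta_4^b\bigr)_{a,b\ge 0,\ a+b=k}$ is a basis of $M_{2k}(\Gamma_0(4))$. This basis is unitary upper triangular: for all $a,b\ge0$, the $q$-expansion of $E^a\Delta_4^b$ is $q^b+O(q^{b+1})$. -/

import Mathlib

namespace LevelFour

open UpperHalfPlane

/-- The space `M_w(Γ₀(N))` of holomorphic modular forms of weight `w` on `Γ₀(N)`, as a complex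
vector space of functions on the upper half plane (the functions underlying Mathlib's
`ModularForm`). -/
def modularFormSpace (N : ℕ) (w : ℤ) : Submodule ℂ (ℍ → ℂ) where
  carrier := {f | ∃ g : ModularForm
    ((CongruenceSubgroup.Gamma0 N).map (Matrix.SpecialLinearGroup.mapGL ℝ)) w, (g : ℍ → ℂ) = f}
  zero_mem' := ⟨0, rfl⟩
  add_mem' := by
    rintro _ _ ⟨f, rfl⟩ ⟨g, rfl⟩
    exact ⟨f + g, rfl⟩
  smul_mem' := by
    rintro c _ ⟨f, rfl⟩
    exact ⟨c • f, rfl⟩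

/-- The renormalized Weierstrass function
`℘̃(z, τ) = π⁻² ∑_{(n,m) ∈ ℤ²} (1/(z + (n+1/2) + (m+1/2)τ)² - 1/((n+1/2) + (m+1/2)τ)²)`. -/
noncomputable def wpTilde (z τ : ℂ) : ℂ :=
  1 / (Real.pi : ℂ) ^ 2 * ∑' p : ℤ × ℤ,
    (1 / (z + ((p.1 : ℂ) + 1 / 2) + ((p.2 : ℂ) + 1 / 2) * τ) ^ 2
      - 1 / (((p.1 : ℂ) + 1 / 2) + ((p.2 : ℂ) + 1 / 2) * τ) ^ 2)

/-- The form `E_{2,4}^{(0)}(τ) = ℘̃(τ, 2τ)`. -/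
noncomputable def E24 : ℍ → ℂ := fun τ => wpTilde (τ : ℂ) (2 * (τ : ℂ))

/-- The form `Δ₄(τ) = η(4τ)⁸ / η(2τ)⁴`, with `η` the Dedekind eta function. -/
noncomputable def Delta4 : ℍ → ℂ := fun τ =>
  ModularForm.eta (4 * (τ : ℂ)) ^ 8 / ModularForm.eta (2 * (τ : ℂ)) ^ 4

end LevelFour

namespace LevelFour

open UpperHalfPlane hiding I
open Filter Topology Complex
open scoped MatrixGroups ModularForm PeriodPair Manifold

local notation "𝕢" => Function.Periodic.qParam

/-! Write `e₁, e₂, e₃` for the values of `℘` at the half periods `1/2`, `τ/2`, `(τ+1)/2`. Up to the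
factor `π⁻²`, `E24` is `e₁ - e₃` and `-16 * Delta4` is `e₂ - e₃`, both taken at `2τ`. `SL(2, ℤ)`
permutes the half periods through its reduction mod 2, so these differences have weight 2, and their
expansions in the nome `t = exp(πiτ)` give their limits at every cusp.

The quotient `e23⁶ Δ(τ) / Δ(2τ)²` is invariant under `Γ₀(2)` and bounded at the cusps, hence
constant (`e23Quotient_eq`). Applying `S` gives the analogous identity for `e13`. Both forms
therefore have no zeros, and since a continuous sixth root of unity on a connected space is
constant, the eta quotients follow.

Consequently `Delta4` vanishes only at the cusp `∞`, and there to order exactly one. A form that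
tends to 0 at `∞` is then `Delta4` times a form of weight two less (`div_Delta4_mem`). Subtracting a
multiple of `E24 ^ k`, which tends to 1, and descending to the constants in weight 0 gives
generation by monomials. They are independent because `Delta4 / E24` takes infinitely many values.
-/

/-! ### Half-period values of `℘` and their transformation under `SL(2, ℤ)`. -/

lemma linearIndependent_one_coe (τ : ℍ) : LinearIndependent ℝ ![(1 : ℂ), (τ : ℂ)] := by
  rw [LinearIndependent.pair_iff]
  intro s t h
  have h2 := congrArg Complex.im h
  have ht : t = 0 := by simpa [τ.im_pos.ne'] using h2
  subst ht
  simpa using h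

/-- The lattice `ℤ + ℤτ`. -/
noncomputable def latticePair (τ : ℍ) : PeriodPair := ⟨1, τ, linearIndependent_one_coe τ⟩

lemma mem_latticePair {τ : ℍ} {x : ℂ} :
    x ∈ (latticePair τ).lattice ↔ ∃ m n : ℤ, (m : ℂ) + n * τ = x := by
  simp [PeriodPair.mem_lattice, latticePair]

/-- The value of `℘` for the lattice `ℤ + ℤτ` at the half period `(mτ + n)/2`. -/
noncomputable def halfP (m n : ℤ) (τ : ℍ) : ℂ := ℘[latticePair τ] ((m * τ + n) / 2)

lemma halfP_add_two_mul (m n k l : ℤ) (τ : ℍ) : halfP (m + 2 * k) (n + 2 * l) τ = halfP m n τ := by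
  have h : (l : ℂ) + k * τ ∈ (latticePair τ).lattice := mem_latticePair.2 ⟨l, k, rfl⟩
  rw [halfP, halfP, ← (latticePair τ).weierstrassP_add_coe ((m * τ + n) / 2) ⟨_, h⟩]
  congr 1
  push_cast
  ring_nf

lemma halfP_congr {m n m' n' : ℤ} (hm : m % 2 = m' % 2) (hn : n % 2 = n' % 2) (τ : ℍ) :
    halfP m n τ = halfP m' n' τ := by
  obtain ⟨k, rfl⟩ : ∃ k, m = m' + 2 * k := ⟨(m - m') / 2, by omega⟩
  obtain ⟨l, rfl⟩ : ∃ l, n = n' + 2 * l := ⟨(n - n') / 2, by omega⟩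
  exact halfP_add_two_mul ..

lemma weierstrassP_of_lattice_scale {L L' : PeriodPair} {c : ℂ} (hc : c ≠ 0)
    (h : ∀ z, z ∈ L'.lattice ↔ c * z ∈ L.lattice) (z : ℂ) :
    ℘[L'] z = c ^ 2 * ℘[L] (c * z) := by
  let e : L'.lattice ≃ L.lattice :=
    (Equiv.mulLeft₀ c hc).subtypeEquiv (fun a => h a)
  rw [PeriodPair.weierstrassP, PeriodPair.weierstrassP, ← e.tsum_eq, ← tsum_mul_left]
  refine tsum_congr fun l => ?_
  have : ((e l : L.lattice) : ℂ) = c * l := rfl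
  rw [this, ← mul_sub, mul_pow, mul_pow, mul_sub]
  congr 1
  · field_simp
  · field_simp

/-- Multiplication by `cτ + d` carries `ℤ + ℤ(γτ)` onto `ℤ + ℤτ` because `det γ = 1`, and it sends
the half period with row vector `(m, n)` to the one with row vector `(m, n)γ`. The factor is the
homogeneity of `℘`. -/
lemma halfP_smul (γ : SL(2, ℤ)) (m n : ℤ) (τ : ℍ) :
    halfP m n (γ • τ) = denom γ τ ^ 2 *
      halfP (m * γ 0 0 + n * γ 1 0) (m * γ 0 1 + n * γ 1 1) τ := by
  have hd : denom γ τ ≠ 0 := denom_ne_zero _ _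
  have hdet : (γ 0 0) * (γ 1 1) - (γ 0 1) * (γ 1 0) = 1 := by
    rw [← Matrix.det_fin_two]; exact γ.2
  have hmul : denom γ τ * (γ • τ : ℍ) = γ 0 0 * τ + γ 0 1 := by
    rw [coe_specialLinearGroup_apply, ModularGroup.denom_apply] 
    rw [ModularGroup.denom_apply] at hd
    simp at hd ⊢
    field_simp
  have hda : denom γ τ = γ 1 0 * τ + γ 1 1 := by
    rw [ModularGroup.denom_apply]
  rw [halfP, halfP, weierstrassP_of_lattice_scale (L := latticePair τ) hd]
  · congr 2
    rw [mul_div_assoc', mul_add, mul_left_comm, hmul, hda]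
    push_cast
    ring
  · intro z
    simp only [mem_latticePair]
    constructor
    · rintro ⟨k, l, rfl⟩
      refine ⟨k * γ 1 1 + l * γ 0 1, k * γ 1 0 + l * γ 0 0, ?_⟩
      rw [mul_add, mul_left_comm _ (l : ℂ), hmul, hda]
      push_cast
      ring
    · rintro ⟨k, l, h⟩
      refine ⟨k * γ 0 0 - l * γ 0 1, l * γ 1 1 - k * γ 1 0, ?_⟩
      apply mul_left_cancel₀ hd
      rw [← h, mul_add, mul_left_comm _ (_ : ℂ) ((γ • τ : ℍ) : ℂ), hmul, hda]
      have hdet' : (γ 0 0 : ℂ) * (γ 1 1) - (γ 0 1) * (γ 1 0) = 1 := by exact_mod_cast hdet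
      push_cast
      linear_combination (k + l * (τ : ℂ)) * hdet'

/-- The correction terms `1/l²` of the two `℘` series cancel in the difference. -/
lemma hasSum_weierstrassP_sub (τ : ℍ) (z w : ℂ) :
    HasSum (fun p : ℤ × ℤ => 1 / (z + p.1 + p.2 * τ) ^ 2 - 1 / (w + p.1 + p.2 * τ) ^ 2)
      (℘[latticePair τ] z - ℘[latticePair τ] w) := by
  let L := latticePair τ
  have h := (L.hasSum_weierstrassP z).sub (L.hasSum_weierstrassP w)
  -- The series for `℘` runs over `1/(z - l)²`; negating the index turns this into `z + l`.
  rw [← (L.latticeEquivProd.symm.toEquiv).hasSum_iff, ← (Equiv.neg (ℤ × ℤ)).hasSum_iff] at h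
  refine Eq.mp (congrArg (HasSum (L := SummationFilter.unconditional _) · (℘[L] z - ℘[L] w))
    (funext fun p => ?_)) h
  have h1 : ((L.latticeEquivProd.symm (-p) : L.lattice) : ℂ) = - (p.1 + p.2 * τ) := by
    rw [L.latticeEquiv_symm_apply]
    simp [L, latticePair]
    ring
  simp only [Function.comp, Equiv.neg_apply, LinearEquiv.coe_toEquiv, h1, sub_neg_eq_add, add_assoc]
  ring

/-- The function `π⁻² (e₁ - e₃)` of `τ`. -/
noncomputable def e13 (τ : ℍ) : ℂ := 1 / (Real.pi : ℂ) ^ 2 * (halfP 0 1 τ - halfP 1 1 τ)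

/-- The function `π⁻² (e₂ - e₃)` of `τ`. -/
noncomputable def e23 (τ : ℍ) : ℂ := 1 / (Real.pi : ℂ) ^ 2 * (halfP 1 0 τ - halfP 1 1 τ)

/-- The function `π⁻² (e₁ - e₂)` of `τ`. -/
noncomputable def e12 (τ : ℍ) : ℂ := 1 / (Real.pi : ℂ) ^ 2 * (halfP 0 1 τ - halfP 1 0 τ)

lemma wpTilde_eq (z : ℂ) (τ : ℍ) : wpTilde z τ = 1 / (Real.pi : ℂ) ^ 2 *
    (℘[latticePair τ] (z + (τ + 1) / 2) - ℘[latticePair τ] ((τ + 1) / 2)) := by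
  rw [wpTilde, ← (hasSum_weierstrassP_sub τ _ _).tsum_eq]
  congr 1
  refine tsum_congr fun p => ?_
  ring

/-- `τ/2 + (τ+1)/2 = τ + 1/2` is congruent to `1/2` modulo the lattice. -/
lemma wpTilde_half_self (τ : ℍ) : wpTilde ((τ : ℂ) / 2) τ = e13 τ := by
  rw [wpTilde_eq, e13, halfP_congr (m := 0) (n := 1) (m' := 2) (n' := 1) rfl rfl, halfP, halfP]
  push_cast
  ring_nf

lemma wpTilde_one_half (τ : ℍ) : wpTilde (1 / 2) τ = e23 τ := by
  rw [wpTilde_eq, e23, halfP_congr (m := 1) (n := 0) (m' := 1) (n' := 2) rfl rfl, halfP, halfP]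
  push_cast
  ring_nf

lemma e12_eq (τ : ℍ) : e12 τ = e13 τ - e23 τ := by
  rw [e12, e13, e23]; ring

lemma det_eq (γ : SL(2, ℤ)) : γ 0 0 * γ 1 1 - γ 0 1 * γ 1 0 = 1 := by
  rw [← Matrix.det_fin_two]; exact γ.2

/-- The possible residues modulo `2` of an element of `SL(2, ℤ)`. -/
lemma emod_two_cases (γ : SL(2, ℤ)) :
    (γ 1 0 % 2 = 0 → γ 0 0 % 2 = 1 ∧ γ 1 1 % 2 = 1) ∧
    (γ 0 1 % 2 = 0 → γ 0 0 % 2 = 1 ∧ γ 1 1 % 2 = 1) ∧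
    (γ 0 0 % 2 = 0 ∨ γ 1 1 % 2 = 0 → γ 0 1 % 2 = 1 ∧ γ 1 0 % 2 = 1) ∧
    (γ 0 0 % 2 = 1 ∧ γ 1 1 % 2 = 1 → γ 0 1 % 2 = 0 ∨ γ 1 0 % 2 = 0) := by
  have h := congrArg (Int.cast : ℤ → ZMod 2) (det_eq γ)
  push_cast at h
  have key (n : ℤ) : (n % 2 = 0 ↔ (n : ZMod 2) = 0) ∧ (n % 2 = 1 ↔ (n : ZMod 2) = 1) :=
    ⟨by rw [ZMod.intCast_zmod_eq_zero_iff_dvd, Int.dvd_iff_emod_eq_zero]; rfl, by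
      rw [← Int.cast_one (R := ZMod 2), ZMod.intCast_eq_intCast_iff]; rfl⟩
  simp only [(key _).1, (key _).2]
  generalize ((γ 0 0 : ℤ) : ZMod 2) = a at *
  generalize ((γ 0 1 : ℤ) : ZMod 2) = b at *
  generalize ((γ 1 0 : ℤ) : ZMod 2) = c at *
  generalize ((γ 1 1 : ℤ) : ZMod 2) = d at *
  revert a b c d
  decide

lemma halfP_eq_of_emod (m n i j : ℤ) (hm : m % 2 = i % 2) (hn : n % 2 = j % 2) :
    halfP m n = halfP i j := funext (halfP_congr hm hn)

lemma e13_smul (γ : SL(2, ℤ)) (τ : ℍ) : e13 (γ • τ) = denom γ τ ^ 2 * (1 / (Real.pi : ℂ) ^ 2 *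
    (halfP (γ 1 0) (γ 1 1) τ - halfP (γ 0 0 + γ 1 0) (γ 0 1 + γ 1 1) τ)) := by
  simp only [e13, halfP_smul, zero_mul, one_mul, zero_add]
  ring

lemma e23_smul (γ : SL(2, ℤ)) (τ : ℍ) : e23 (γ • τ) = denom γ τ ^ 2 * (1 / (Real.pi : ℂ) ^ 2 *
    (halfP (γ 0 0) (γ 0 1) τ - halfP (γ 0 0 + γ 1 0) (γ 0 1 + γ 1 1) τ)) := by
  simp only [e23, halfP_smul, zero_mul, one_mul, add_zero]
  ring

lemma e13_smul_of_even {γ : SL(2, ℤ)} (hb : γ 0 1 % 2 = 0) (hc : γ 1 0 % 2 = 0) (τ : ℍ) :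
    e13 (γ • τ) = denom γ τ ^ 2 * e13 τ := by
  have h := (emod_two_cases γ).1 hc
  rw [e13_smul, e13, halfP_eq_of_emod (γ 1 0) (γ 1 1) 0 1
      (by omega) (by omega),
    halfP_eq_of_emod (γ 0 0 + γ 1 0) (γ 0 1 + γ 1 1) 1 1
      (by omega) (by omega)]

lemma e23_smul_of_even {γ : SL(2, ℤ)} (hb : γ 0 1 % 2 = 0) (hc : γ 1 0 % 2 = 0) (τ : ℍ) :
    e23 (γ • τ) = denom γ τ ^ 2 * e23 τ := by
  have h := (emod_two_cases γ).1 hc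
  rw [e23_smul, e23, halfP_eq_of_emod (γ 0 0) (γ 0 1) 1 0
      (by omega) (by omega),
    halfP_eq_of_emod (γ 0 0 + γ 1 0) (γ 0 1 + γ 1 1) 1 1
      (by omega) (by omega)]

lemma e23_smul_of_bot_even {γ : SL(2, ℤ)} (hc : γ 1 0 % 2 = 0) :
    ∃ ε : ℂ, ε ^ 2 = 1 ∧ ∀ τ, e23 (γ • τ) = denom γ τ ^ 2 * (ε * e23 τ) := by
  have h := (emod_two_cases γ).1 hc
  rcases Int.emod_two_eq_zero_or_one (γ 0 1) with hb | hb
  · exact ⟨1, by norm_num, fun τ => by rw [one_mul, e23_smul_of_even hb hc]⟩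
  · refine ⟨-1, by norm_num, fun τ => ?_⟩
    rw [e23_smul, e23, halfP_eq_of_emod (γ 0 0) (γ 0 1) 1 1
      (by omega) (by omega),
      halfP_eq_of_emod (γ 0 0 + γ 1 0) (γ 0 1 + γ 1 1) 1 0
      (by omega) (by omega)]
    ring

/-- With `c` odd, the half period missing from the transformed pair, of row vector `(c, d)`, is not
`1/2`. So `e₁` occurs in the difference, which is what makes the limit at `i∞` nonzero. -/
lemma e23_smul_of_bot_odd {γ : SL(2, ℤ)} (hc : γ 1 0 % 2 = 1) :
    ∃ ε : ℂ, ε ^ 2 = 1 ∧ ((∀ τ, e23 (γ • τ) = denom γ τ ^ 2 * (ε * e13 τ)) ∨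
      ∀ τ, e23 (γ • τ) = denom γ τ ^ 2 * (ε * e12 τ)) := by
  obtain ⟨-, h2, h3, h4⟩ := emod_two_cases γ
  rcases Int.emod_two_eq_zero_or_one (γ 1 1) with hd | hd <;>
  rcases Int.emod_two_eq_zero_or_one (γ 0 0) with ha | ha
  · refine ⟨1, by norm_num, .inl fun τ => ?_⟩
    rw [e23_smul, e13, halfP_eq_of_emod (γ 0 0) (γ 0 1) 0 1
      (by omega) (by omega),
      halfP_eq_of_emod (γ 0 0 + γ 1 0) (γ 0 1 + γ 1 1) 1 1
      (by omega) (by omega)]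
    ring
  · refine ⟨-1, by norm_num, .inl fun τ => ?_⟩
    rw [e23_smul, e13, halfP_eq_of_emod (γ 0 0) (γ 0 1) 1 1
      (by omega) (by omega),
      halfP_eq_of_emod (γ 0 0 + γ 1 0) (γ 0 1 + γ 1 1) 0 1
      (by omega) (by omega)]
    ring
  · refine ⟨1, by norm_num, .inr fun τ => ?_⟩
    rw [e23_smul, e12, halfP_eq_of_emod (γ 0 0) (γ 0 1) 0 1
      (by omega) (by omega),
      halfP_eq_of_emod (γ 0 0 + γ 1 0) (γ 0 1 + γ 1 1) 1 0
      (by omega) (by omega)]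
    ring
  · refine ⟨-1, by norm_num, .inr fun τ => ?_⟩
    rw [e23_smul, e12, halfP_eq_of_emod (γ 0 0) (γ 0 1) 1 0
      (by omega) (by omega),
      halfP_eq_of_emod (γ 0 0 + γ 1 0) (γ 0 1 + γ 1 1) 0 1
      (by omega) (by omega)]
    ring

lemma e13_smul_cases (γ : SL(2, ℤ)) :
    ∃ ε : ℂ, ε ^ 2 = 1 ∧ ((∀ τ, e13 (γ • τ) = denom γ τ ^ 2 * (ε * e13 τ)) ∨
      (∀ τ, e13 (γ • τ) = denom γ τ ^ 2 * (ε * e12 τ)) ∨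
      ∀ τ, e13 (γ • τ) = denom γ τ ^ 2 * (ε * e23 τ)) := by
  obtain ⟨h1, h2, h3, h4⟩ := emod_two_cases γ
  rcases Int.emod_two_eq_zero_or_one (γ 1 0) with hc | hc <;>
  rcases Int.emod_two_eq_zero_or_one (γ 0 0) with ha | ha
  · omega
  · rcases Int.emod_two_eq_zero_or_one (γ 0 1) with hb | hb
    · refine ⟨1, by norm_num, .inl fun τ => ?_⟩
      rw [e13_smul, e13, halfP_eq_of_emod (γ 1 0) (γ 1 1) 0 1
      (by omega) (by omega),
      halfP_eq_of_emod (γ 0 0 + γ 1 0) (γ 0 1 + γ 1 1) 1 1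
      (by omega) (by omega)]
      ring
    · refine ⟨1, by norm_num, .inr <| .inl fun τ => ?_⟩
      rw [e13_smul, e12, halfP_eq_of_emod (γ 1 0) (γ 1 1) 0 1
      (by omega) (by omega),
      halfP_eq_of_emod (γ 0 0 + γ 1 0) (γ 0 1 + γ 1 1) 1 0
      (by omega) (by omega)]
      ring
  · rcases Int.emod_two_eq_zero_or_one (γ 1 1) with hd | hd
    · refine ⟨1, by norm_num, .inr <| .inr fun τ => ?_⟩
      rw [e13_smul, e23, halfP_eq_of_emod (γ 1 0) (γ 1 1) 1 0
      (by omega) (by omega),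
      halfP_eq_of_emod (γ 0 0 + γ 1 0) (γ 0 1 + γ 1 1) 1 1
      (by omega) (by omega)]
      ring
    · refine ⟨-1, by norm_num, .inr <| .inr fun τ => ?_⟩
      rw [e13_smul, e23, halfP_eq_of_emod (γ 1 0) (γ 1 1) 1 1
      (by omega) (by omega),
      halfP_eq_of_emod (γ 0 0 + γ 1 0) (γ 0 1 + γ 1 1) 1 0
      (by omega) (by omega)]
      ring
  · rcases Int.emod_two_eq_zero_or_one (γ 1 1) with hd | hd
    · refine ⟨-1, by norm_num, .inr <| .inl fun τ => ?_⟩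
      rw [e13_smul, e12, halfP_eq_of_emod (γ 1 0) (γ 1 1) 1 0
      (by omega) (by omega),
      halfP_eq_of_emod (γ 0 0 + γ 1 0) (γ 0 1 + γ 1 1) 0 1
      (by omega) (by omega)]
      ring
    · refine ⟨-1, by norm_num, .inl fun τ => ?_⟩
      rw [e13_smul, e13, halfP_eq_of_emod (γ 1 0) (γ 1 1) 1 1
      (by omega) (by omega),
      halfP_eq_of_emod (γ 0 0 + γ 1 0) (γ 0 1 + γ 1 1) 0 1
      (by omega) (by omega)]
      ring

lemma e23_S_smul (τ : ℍ) : e23 (ModularGroup.S • τ) = (τ : ℂ) ^ 2 * e13 τ := by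
  rw [e23_smul, e13, ModularGroup.denom_S]
  simp only [ModularGroup.S, Matrix.SpecialLinearGroup.coe_mk, Matrix.of_apply, Matrix.cons_val',
    Matrix.cons_val_zero, Matrix.cons_val_one, Matrix.cons_val_fin_one]
  rw [halfP_eq_of_emod 0 (-1) 0 1 rfl rfl, halfP_eq_of_emod (0 + 1) (-1 + 0) 1 1 rfl rfl]

/-! ### Expansions in the nome and limits at `i∞`. -/

/-- The rational function `x / (1 - x)²`. -/
noncomputable def koebe (x : ℂ) : ℂ := x / (1 - x) ^ 2

/-- This symmetry folds negative powers of the nome onto positive ones. The cases `x = 0` and `x =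
1` hold by the convention for division by zero. -/
lemma koebe_inv (x : ℂ) : koebe x⁻¹ = koebe x := by
  rcases eq_or_ne x 0 with rfl | hx
  · simp
  rcases eq_or_ne x 1 with rfl | hx1
  · simp
  have h1 : 1 - x ≠ 0 := sub_ne_zero.2 hx1.symm
  have h2 : 1 - x⁻¹ ≠ 0 := sub_ne_zero.2 (by simpa [eq_comm] using hx1)
  have h3 : x - 1 ≠ 0 := sub_ne_zero.2 hx1
  rw [koebe, koebe]
  have : 1 - x⁻¹ = (x - 1) / x := by field_simp
  rw [this]
  field_simp
  ring

lemma summable_one_div_add_int_sq (z : ℂ) : Summable fun n : ℤ => 1 / (z + n) ^ 2 := by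
  refine (EisensteinSeries.linear_right_summable z 1 (k := 2) le_rfl).congr fun n => ?_
  simp [zpow_ofNat]

/-- Lipschitz's formula in weight 2, with `∑ n qⁿ = q / (1 - q)²`. -/
lemma tsum_one_div_add_int_sq_of_im_pos {z : ℂ} (hz : 0 < z.im) :
    ∑' n : ℤ, 1 / (z + n) ^ 2 = -4 * Real.pi ^ 2 * koebe (cexp (2 * Real.pi * I * z)) := by
  have h := EisensteinSeries.qExpansion_identity (k := 1) le_rfl ⟨z, hz⟩
  have hq : ‖cexp (2 * Real.pi * I * z)‖ < 1 := norm_exp_two_pi_I_lt_one ⟨z, hz⟩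
  simp only [pow_one, Nat.reduceAdd, Nat.factorial_one, Nat.cast_one, div_one] at h
  rw [h, tsum_coe_mul_geometric_of_norm_lt_one hq, koebe]
  ring_nf
  simp

lemma hasSum_one_div_add_int_sq {z : ℂ} (hz : z.im ≠ 0) :
    HasSum (fun n : ℤ => 1 / (z + n) ^ 2)
      (-4 * Real.pi ^ 2 * koebe (cexp (2 * Real.pi * I * z))) := by
  refine (summable_one_div_add_int_sq z).hasSum_iff.2 ?_
  rcases hz.lt_or_gt with h | h
  · have h1 := tsum_one_div_add_int_sq_of_im_pos (z := -z) (by simpa using h)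
    rw [mul_neg, Complex.exp_neg, koebe_inv] at h1
    rw [← h1, ← (Equiv.neg ℤ).tsum_eq]
    refine tsum_congr fun n => ?_
    rw [Equiv.neg_apply, Int.cast_neg, show z + -(n : ℂ) = -(-z + n) by ring, neg_sq]
  · exact tsum_one_div_add_int_sq_of_im_pos h

lemma hasSum_one_div_odd_sq :
    HasSum (fun n : ℕ => 1 / (2 * (n : ℂ) + 1) ^ 2) ((Real.pi : ℂ) ^ 2 / 8) := by
  have hZ : HasSum (fun n : ℕ => 1 / (n : ℂ) ^ 2) ((Real.pi : ℂ) ^ 2 / 6) := by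
    have h := Complex.hasSum_ofReal.2 hasSum_zeta_two
    push_cast at h
    exact h
  have he : HasSum (fun n : ℕ => 1 / ((2 * n : ℕ) : ℂ) ^ 2)
      (1 / 4 * ((Real.pi : ℂ) ^ 2 / 6)) := by
    refine (hZ.mul_left (1 / 4)).congr_fun fun n => ?_
    push_cast
    ring
  have hi : Function.Injective fun n : ℕ => 2 * n + 1 := fun a b h => by
    simpa using h
  obtain ⟨c, hc⟩ : Summable fun n : ℕ => 1 / ((2 * n + 1 : ℕ) : ℂ) ^ 2 :=
    hZ.summable.comp_injective hi
  have hs := (HasSum.even_add_odd (f := fun n : ℕ => 1 / (n : ℂ) ^ 2) he hc).unique hZ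
  have : c = (Real.pi : ℂ) ^ 2 / 8 := by linear_combination hs
  subst this
  push_cast at hc
  exact hc

/-- The real point `z = 1/2` gives `q = -1`, outside the reach of Lipschitz's formula; the value
`π²` comes from `ζ(2)` instead. This row produces the constant term of `e13`. -/
lemma hasSum_one_div_half_add_int_sq :
    HasSum (fun n : ℤ => 1 / ((1 / 2 : ℂ) + n) ^ 2) (-4 * Real.pi ^ 2 * koebe (-1)) := by
  have h := hasSum_one_div_odd_sq.mul_left 4
  have : -4 * (Real.pi : ℂ) ^ 2 * koebe (-1) =
      4 * ((Real.pi : ℂ) ^ 2 / 8) + 4 * ((Real.pi : ℂ) ^ 2 / 8) := by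
    rw [koebe]; ring
  rw [this]
  have h1 (n : ℕ) : (2 * (n : ℂ) + 1) ≠ 0 := by exact_mod_cast (2 * n).succ_ne_zero
  have h2 (n : ℕ) : ((1 / 2 : ℂ) + n) ≠ 0 := by
    rw [show (1 / 2 : ℂ) + n = (2 * n + 1) / 2 by ring]
    exact div_ne_zero (h1 n) two_ne_zero
  refine HasSum.of_nat_of_neg_add_one (h.congr_fun fun n => ?_) (h.congr_fun fun n => ?_)
  · rw [show (1 / 2 : ℂ) + ((n : ℤ) : ℂ) = (2 * n + 1) / 2 by push_cast; ring, div_pow]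
    have := h1 n
    field_simp
    norm_num
  · rw [show (1 / 2 : ℂ) + ((-(n + 1 : ℤ) : ℤ) : ℂ) = -(2 * n + 1) / 2 by push_cast; ring, div_pow]
    have := h1 n
    field_simp
    norm_num

lemma qParam_two_zpow (z : ℂ) (k : ℤ) :
    𝕢 2 z ^ k = cexp (2 * Real.pi * I * (k * z / 2)) := by
  rw [Function.Periodic.qParam, ← Complex.exp_int_mul]
  congr 1
  push_cast
  ring

lemma hasSum_one_div_int_mul_add (τ : ℍ) {k : ℤ} (hk : k ≠ 0) :
    HasSum (fun n : ℤ => 1 / ((k * τ / 2 : ℂ) + n) ^ 2)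
      (-4 * Real.pi ^ 2 * koebe (𝕢 2 τ ^ k)) := by
  rw [qParam_two_zpow]
  exact hasSum_one_div_add_int_sq (by simpa using ⟨hk, τ.im_pos.ne'⟩)

lemma hasSum_one_div_half_add_int_mul_add (τ : ℍ) (k : ℤ) :
    HasSum (fun n : ℤ => 1 / ((1 / 2 + k * τ / 2 : ℂ) + n) ^ 2)
      (-4 * Real.pi ^ 2 * koebe (-𝕢 2 τ ^ k)) := by
  rcases eq_or_ne k 0 with rfl | hk
  · simpa using hasSum_one_div_half_add_int_sq
  · have h := hasSum_one_div_add_int_sq (z := 1 / 2 + k * τ / 2)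
      (by simpa using ⟨hk, τ.im_pos.ne'⟩)
    rwa [mul_add, Complex.exp_add, ← qParam_two_zpow, show 2 * (Real.pi : ℂ) * I * (1 / 2) =
      Real.pi * I by ring, Complex.exp_pi_mul_I, neg_one_mul] at h

lemma hasSum_e13_int (τ : ℍ) :
    HasSum (fun m : ℤ => -4 * (koebe (-𝕢 2 τ ^ (2 * m)) - koebe (-𝕢 2 τ ^ (2 * m + 1)))) (e13 τ) := by
  have h := (Equiv.prodComm ℤ ℤ).hasSum_iff.2
    (hasSum_weierstrassP_sub τ (((0 : ℤ) * τ + (1 : ℤ)) / 2) (((1 : ℤ) * τ + (1 : ℤ)) / 2))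
  -- Unconditional convergence of the double sum allows summing over `n` first, for each fixed `m`.
  have h2 := h.prod_fiberwise fun m => by
    refine ((hasSum_one_div_half_add_int_mul_add τ (2 * m)).sub
      (hasSum_one_div_half_add_int_mul_add τ (2 * m + 1))).congr_fun fun n => ?_
    simp only [Function.comp, Equiv.prodComm_apply, Prod.swap]
    push_cast
    ring_nf
  have h3 := h2.mul_left (1 / (Real.pi : ℂ) ^ 2)
  refine h3.congr_fun fun m => ?_
  have : (Real.pi : ℂ) ≠ 0 := by exact_mod_cast Real.pi_ne_zero
  field_simp
  ring

lemma hasSum_e23_int (τ : ℍ) :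
    HasSum (fun m : ℤ => -4 * (koebe (𝕢 2 τ ^ (2 * m + 1)) - koebe (-𝕢 2 τ ^ (2 * m + 1)))) (e23 τ) := by
  have h := (Equiv.prodComm ℤ ℤ).hasSum_iff.2
    (hasSum_weierstrassP_sub τ (((1 : ℤ) * τ + (0 : ℤ)) / 2) (((1 : ℤ) * τ + (1 : ℤ)) / 2))
  have h2 := h.prod_fiberwise fun m => by
    refine ((hasSum_one_div_int_mul_add τ (k := 2 * m + 1) (by omega)).sub
      (hasSum_one_div_half_add_int_mul_add τ (2 * m + 1))).congr_fun fun n => ?_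
    simp only [Function.comp, Equiv.prodComm_apply, Prod.swap]
    push_cast
    ring_nf
  have h3 := h2.mul_left (1 / (Real.pi : ℂ) ^ 2)
  refine h3.congr_fun fun m => ?_
  have : (Real.pi : ℂ) ≠ 0 := by exact_mod_cast Real.pi_ne_zero
  field_simp
  ring

/-- The expansion of `e13` in the nome. -/
noncomputable def e13Series (t : ℂ) : ℂ :=
  ∑' m : ℕ, -4 * (koebe (-t ^ (2 * m)) + koebe (-t ^ (2 * m + 2)) - 2 * koebe (-t ^ (2 * m + 1)))

/-- The expansion of `e23` in the nome, divided by the nome. -/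
noncomputable def e23Series (t : ℂ) : ℂ :=
  ∑' m : ℕ, -8 * (t ^ (2 * m) * (1 / (1 - t ^ (2 * m + 1)) ^ 2 + 1 / (1 + t ^ (2 * m + 1)) ^ 2))

/-- The index `m ≥ 0` is paired with `-m - 1`: the exponents `2m`, `2m + 1` become `-(2m + 2)`,
`-(2m + 1)`, and `koebe_inv` removes the signs. -/
lemma e13_eq_series (τ : ℍ) : e13 τ = e13Series (𝕢 2 τ) := by
  refine ((hasSum_e13_int τ).nat_add_neg_add_one.congr_fun fun m => ?_).tsum_eq.symm
  have h1 : koebe (-𝕢 2 τ ^ (2 * (-((m : ℤ) + 1)))) = koebe (-𝕢 2 τ ^ (2 * m + 2)) := by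
    rw [← koebe_inv, inv_neg, ← zpow_neg, ← zpow_natCast]
    congr 3
  have h2 : koebe (-𝕢 2 τ ^ (2 * (-((m : ℤ) + 1)) + 1)) = koebe (-𝕢 2 τ ^ (2 * m + 1)) := by
    rw [← koebe_inv, inv_neg, ← zpow_neg, ← zpow_natCast]
    congr 3
  have h3 : 𝕢 2 τ ^ (2 * (m : ℤ)) = 𝕢 2 τ ^ (2 * m) := by exact_mod_cast rfl
  have h4 : 𝕢 2 τ ^ (2 * (m : ℤ) + 1) = 𝕢 2 τ ^ (2 * m + 1) := by exact_mod_cast rfl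
  rw [h1, h2, h3, h4]
  ring

lemma e23_eq_series (τ : ℍ) : e23 τ = 𝕢 2 τ * e23Series (𝕢 2 τ) := by
  rw [e23Series, ← tsum_mul_left]
  refine ((hasSum_e23_int τ).nat_add_neg_add_one.congr_fun fun m => ?_).tsum_eq.symm
  have h0 : 𝕢 2 τ ^ (2 * (-((m : ℤ) + 1)) + 1) = (𝕢 2 τ ^ (2 * m + 1))⁻¹ := by
    rw [← zpow_natCast, ← zpow_neg]
    congr 1
  have h1 : 𝕢 2 τ ^ (2 * (m : ℤ) + 1) = 𝕢 2 τ ^ (2 * m + 1) := by exact_mod_cast rfl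
  rw [h0, ← inv_neg, koebe_inv, koebe_inv, h1, koebe, koebe, sub_neg_eq_add]
  ring

lemma norm_one_div_one_sub_sq_le {r : ℝ} (hr : r < 1) {x : ℂ} (hx : 1 - r ≤ ‖1 - x‖) :
    ‖1 / (1 - x) ^ 2‖ ≤ 1 / (1 - r) ^ 2 := by
  rw [norm_div, norm_one, norm_pow]
  have : 0 < 1 - r := by linarith
  gcongr

lemma one_sub_le_norm_one_sub {r : ℝ} {x : ℂ} (hx : ‖x‖ ≤ r) : 1 - r ≤ ‖1 - x‖ := by
  have := norm_sub_norm_le (1 : ℂ) x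
  rw [norm_one] at this
  linarith

lemma norm_pow_le_self {r : ℝ} (hr : r < 1) {t : ℂ} (ht : ‖t‖ ≤ r) {k : ℕ} (hk : k ≠ 0) :
    ‖t ^ k‖ ≤ r := by
  rw [norm_pow]
  exact (pow_le_of_le_one (norm_nonneg _) (ht.trans hr.le) hk).trans ht

lemma one_sub_le_norm_one_add_pow {r : ℝ} (hr : r < 1) {t : ℂ} (ht : ‖t‖ ≤ r) (k : ℕ) :
    1 - r ≤ ‖1 - -t ^ k‖ := by
  rcases eq_or_ne k 0 with rfl | hk
  · have := (norm_nonneg t).trans ht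
    norm_num
    linarith
  · exact one_sub_le_norm_one_sub (by rw [norm_neg]; exact norm_pow_le_self hr ht hk)

lemma norm_koebe_neg_pow_le {r : ℝ} (hr : r < 1) {t : ℂ} (ht : ‖t‖ ≤ r) {k m : ℕ} (hkm : m ≤ k) :
    ‖koebe (-t ^ k)‖ ≤ r ^ m * (1 / (1 - r) ^ 2) := by
  have h0 := (norm_nonneg t).trans ht
  rw [koebe, div_eq_mul_one_div, norm_mul]
  gcongr
  · rw [norm_neg, norm_pow]
    exact (pow_le_pow_left₀ (norm_nonneg _) ht k).trans (pow_le_pow_of_le_one h0 hr.le hkm)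
  · exact norm_one_div_one_sub_sq_le hr (one_sub_le_norm_one_add_pow hr ht k)

lemma differentiableOn_ball_one_of_forall {f : ℂ → ℂ}
    (h : ∀ r : ℝ, 0 < r → r < 1 → DifferentiableOn ℂ f (Metric.ball 0 r)) :
    DifferentiableOn ℂ f (Metric.ball 0 1) := by
  intro t ht
  obtain ⟨r, hr, hr1⟩ := exists_between (mem_ball_zero_iff.1 ht)
  exact ((h r ((norm_nonneg _).trans_lt hr) hr1).differentiableAt
    (Metric.isOpen_ball.mem_nhds (mem_ball_zero_iff.2 hr))).differentiableWithinAt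

lemma differentiableOn_e13Series : DifferentiableOn ℂ e13Series (Metric.ball 0 1) := by
  refine differentiableOn_ball_one_of_forall fun r hr0 hr => ?_
  have hr' : 0 < 1 - r := by linarith
  refine differentiableOn_tsum_of_summable_norm
    (u := fun m => 4 * (4 * (r ^ m * (1 / (1 - r) ^ 2))))
    ((((summable_geometric_of_lt_one hr0.le hr).mul_right _).mul_left _).mul_left _) ?_
    Metric.isOpen_ball ?_
  · intro m
    have hd (k : ℕ) : DifferentiableOn ℂ (fun t : ℂ => koebe (-t ^ k)) (Metric.ball 0 r) := by
      refine DifferentiableOn.div (by fun_prop) (by fun_prop) fun t ht => pow_ne_zero _ ?_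
      have := one_sub_le_norm_one_add_pow hr (mem_ball_zero_iff.1 ht).le k
      exact norm_pos_iff.1 (hr'.trans_le this)
    exact (((hd _).add (hd _)).sub ((hd _).const_mul 2)).const_mul _
  · intro m t ht
    have ht' := (mem_ball_zero_iff.1 ht).le
    rw [norm_mul, norm_neg]
    have h1 := norm_koebe_neg_pow_le hr ht' (k := 2 * m) (m := m) (by omega)
    have h2 := norm_koebe_neg_pow_le hr ht' (k := 2 * m + 2) (m := m) (by omega)
    have h3 := norm_koebe_neg_pow_le hr ht' (k := 2 * m + 1) (m := m) (by omega)
    have h4 := norm_sub_le (koebe (-t ^ (2 * m)) + koebe (-t ^ (2 * m + 2)))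
      (2 * koebe (-t ^ (2 * m + 1)))
    have h5 := norm_add_le (koebe (-t ^ (2 * m))) (koebe (-t ^ (2 * m + 2)))
    rw [norm_mul] at h4
    norm_num at h4 ⊢
    simp only [one_div] at *
    linarith

lemma differentiableOn_e23Series : DifferentiableOn ℂ e23Series (Metric.ball 0 1) := by
  refine differentiableOn_ball_one_of_forall fun r hr0 hr => ?_
  have hr' : 0 < 1 - r := by linarith
  have hn (m : ℕ) {t : ℂ} (ht : t ∈ Metric.ball 0 r) :
      1 - r ≤ ‖1 - t ^ (2 * m + 1)‖ ∧ 1 - r ≤ ‖1 - -t ^ (2 * m + 1)‖ := by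
    have ht' := (mem_ball_zero_iff.1 ht).le
    exact ⟨one_sub_le_norm_one_sub (norm_pow_le_self hr ht' (by omega)),
      one_sub_le_norm_one_add_pow hr ht' _⟩
  refine differentiableOn_tsum_of_summable_norm
    (u := fun m => 8 * (r ^ m * (1 / (1 - r) ^ 2 + 1 / (1 - r) ^ 2)))
    (((summable_geometric_of_lt_one hr0.le hr).mul_right _).mul_left _) ?_
    Metric.isOpen_ball ?_
  · intro m
    refine (DifferentiableOn.mul (by fun_prop) (.add (.div (by fun_prop) (by fun_prop) ?_)
      (.div (by fun_prop) (by fun_prop) ?_))).const_mul _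
    · exact fun t ht => pow_ne_zero _ (norm_pos_iff.1 (hr'.trans_le (hn m ht).1))
    · exact fun t ht => pow_ne_zero _ (norm_pos_iff.1 (hr'.trans_le
        (by simpa using (hn m ht).2)))
  · intro m t ht
    have ht' := (mem_ball_zero_iff.1 ht).le
    rw [norm_mul, norm_neg, norm_mul, norm_pow]
    norm_num only [RCLike.norm_ofNat]
    gcongr
    · exact (pow_le_pow_left₀ (norm_nonneg _) ht' _).trans
        (pow_le_pow_of_le_one hr0.le hr.le (by omega))
    · refine (norm_add_le _ _).trans (add_le_add (norm_one_div_one_sub_sq_le hr (hn m ht).1) ?_)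
      simpa using norm_one_div_one_sub_sq_le hr (hn m ht).2

lemma e13Series_zero : e13Series 0 = 1 := by
  rw [e13Series, tsum_eq_single 0]
  · norm_num [koebe]
  · intro m hm
    simp [koebe, hm]

lemma e23Series_zero : e23Series 0 = -16 := by
  rw [e23Series, tsum_eq_single 0]
  · norm_num
  · intro m hm
    simp [hm]

lemma norm_qParam_two_lt_one (τ : ℍ) : 𝕢 2 τ ∈ Metric.ball (0 : ℂ) 1 := by
  rw [mem_ball_zero_iff]
  exact Function.Periodic.norm_qParam_lt_one two_pos τ.im_pos

lemma mdifferentiable_of_series {f : ℍ → ℂ} {F : ℂ → ℂ} (hF : DifferentiableOn ℂ F (Metric.ball 0 1))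
    (hf : ∀ τ : ℍ, f τ = F (𝕢 2 τ)) : MDiff f := by
  rw [UpperHalfPlane.mdifferentiable_iff]
  refine DifferentiableOn.congr (f := fun z => F (𝕢 2 z)) ?_ fun z hz => ?_
  · refine hF.comp (by fun_prop) fun z hz => norm_qParam_two_lt_one ⟨z, hz⟩
  · simp [hf, ofComplex_apply_of_im_pos hz]

lemma mdifferentiable_e13 : MDiff e13 :=
  mdifferentiable_of_series differentiableOn_e13Series e13_eq_series

lemma mdifferentiable_e23 : MDiff e23 :=
  mdifferentiable_of_series (F := fun t => t * e23Series t)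
    (differentiableOn_id.mul differentiableOn_e23Series) e23_eq_series

lemma tendsto_series {F : ℂ → ℂ} (hF : DifferentiableOn ℂ F (Metric.ball 0 1)) :
    Tendsto (fun τ : ℍ => F (𝕢 2 τ)) atImInfty (𝓝 (F 0)) :=
  ((hF.differentiableAt (Metric.ball_mem_nhds 0 one_pos)).continuousAt.tendsto).comp
    (qParam_tendsto_atImInfty two_pos)

lemma tendsto_e13 : Tendsto e13 atImInfty (𝓝 1) := by
  rw [funext e13_eq_series, ← e13Series_zero]
  exact tendsto_series differentiableOn_e13Series

lemma tendsto_e23_div : Tendsto (fun τ : ℍ => e23 τ / 𝕢 2 τ) atImInfty (𝓝 (-16)) := by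
  rw [← e23Series_zero]
  refine (tendsto_series differentiableOn_e23Series).congr fun τ => ?_
  rw [e23_eq_series, mul_div_cancel_left₀ _ (Function.Periodic.qParam_ne_zero _)]

lemma tendsto_e23 : Tendsto e23 atImInfty (𝓝 0) := by
  rw [funext e23_eq_series]
  simpa using (qParam_tendsto_atImInfty two_pos).mul (tendsto_series differentiableOn_e23Series)

lemma tendsto_e12 : Tendsto e12 atImInfty (𝓝 1) := by
  rw [funext e12_eq]
  simpa using tendsto_e13.sub tendsto_e23

/-! ### Modular forms through explicit transformation laws. -/

/-- The cusps of `Γ₀(N)` are the `SL(2, ℤ)`-translates of `∞`, so boundedness at the cusps can be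
tested on each slash `g` of `f`. -/
lemma mem_modularFormSpace_of {N : ℕ} [NeZero N] {k : ℤ} {f : ℍ → ℂ} (hol : MDiff f)
    (inv : ∀ γ ∈ CongruenceSubgroup.Gamma0 N, ∀ τ : ℍ, f (γ • τ) = denom γ τ ^ k * f τ)
    (bdd : ∀ γ : SL(2, ℤ), ∃ g : ℍ → ℂ, IsBoundedAtImInfty g ∧
      ∀ τ : ℍ, f (γ • τ) = denom γ τ ^ k * g τ) :
    f ∈ modularFormSpace N k := by
  have slash (γ : SL(2, ℤ)) (g : ℍ → ℂ) (h : ∀ τ : ℍ, f (γ • τ) = denom γ τ ^ k * g τ) :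
      f ∣[k] γ = g := by
    ext τ
    rw [ModularForm.SL_slash_apply, h, mul_right_comm, ← zpow_add₀ (denom_ne_zero _ _)]
    simp
  refine ⟨{ toFun := f, slash_action_eq' := ?_, holo' := hol, bdd_at_cusps' := ?_ }, rfl⟩
  · rintro _ ⟨γ, hγ, rfl⟩
    exact slash γ f (inv γ hγ)
  · intro c hc
    rw [Subgroup.IsArithmetic.isCusp_iff_isCusp_SL2Z] at hc
    rw [OnePoint.isBoundedAt_iff_forall_SL2Z hc]
    intro γ _
    obtain ⟨g, hg, h⟩ := bdd γ
    rwa [slash γ g h]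

lemma mdifferentiable_of_mem {N : ℕ} {k : ℤ} {f : ℍ → ℂ} (hf : f ∈ modularFormSpace N k) :
    MDiff f := by
  obtain ⟨g, rfl⟩ := hf
  exact g.holo'

lemma smul_eq_of_mem {N : ℕ} {k : ℤ} {f : ℍ → ℂ} (hf : f ∈ modularFormSpace N k) {γ : SL(2, ℤ)}
    (hγ : γ ∈ CongruenceSubgroup.Gamma0 N) (τ : ℍ) : f (γ • τ) = denom γ τ ^ k * f τ := by
  obtain ⟨g, rfl⟩ := hf
  have h := g.slash_action_eq' _ ⟨γ, hγ, rfl⟩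
  have h2 := congrFun h τ
  have h3 : ((g : ℍ → ℂ) ∣[k] γ) τ = g τ := h2
  rw [ModularForm.SL_slash_apply] at h3
  rw [← h3, mul_left_comm, ← zpow_add₀ (denom_ne_zero _ _)]
  simp

lemma exists_bounded_of_mem {N : ℕ} [NeZero N] {k : ℤ} {f : ℍ → ℂ} (hf : f ∈ modularFormSpace N k)
    (γ : SL(2, ℤ)) : ∃ g : ℍ → ℂ, IsBoundedAtImInfty g ∧
      ∀ τ : ℍ, f (γ • τ) = denom γ τ ^ k * g τ := by
  obtain ⟨g, rfl⟩ := hf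
  refine ⟨(g : ℍ → ℂ) ∣[k] γ, ModularFormClass.bdd_at_infty_slash g γ, fun τ => ?_⟩
  rw [ModularForm.SL_slash_apply, mul_left_comm, ← zpow_add₀ (denom_ne_zero _ _)]
  simp

/-! ### The maps `τ ↦ 2τ` and `τ ↦ (τ + x)/2`. -/

/-- The point `2τ`. -/
noncomputable def dbl (τ : ℍ) : ℍ := ⟨2 * τ, by simpa using τ.im_pos⟩

/-- The point `(τ + x) / 2`. -/
noncomputable def half (x : ℝ) (τ : ℍ) : ℍ := ⟨(τ + x) / 2, by simpa using τ.im_pos⟩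

lemma coe_dbl (τ : ℍ) : (dbl τ : ℂ) = 2 * τ := rfl

lemma coe_half (x : ℝ) (τ : ℍ) : (half x τ : ℂ) = (τ + x) / 2 := rfl

lemma half_zero_dbl (τ : ℍ) : half 0 (dbl τ) = τ := by
  ext
  simp [coe_half, coe_dbl]

lemma tendsto_dbl : Tendsto dbl atImInfty atImInfty := by
  rw [atImInfty, tendsto_comap_iff]
  have : (UpperHalfPlane.im ∘ dbl) = fun τ : ℍ => 2 * τ.im := by
    ext τ
    rw [Function.comp, ← coe_im, coe_dbl]
    simp
  rw [this]
  exact tendsto_comap.const_mul_atTop two_pos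

lemma tendsto_half (x : ℝ) : Tendsto (half x) atImInfty atImInfty := by
  rw [atImInfty, tendsto_comap_iff]
  have : (UpperHalfPlane.im ∘ half x) = fun τ : ℍ => 2⁻¹ * τ.im := by
    ext τ
    rw [Function.comp, ← coe_im, coe_half]
    simp
    ring
  rw [this]
  exact tendsto_comap.const_mul_atTop (by norm_num)

lemma mdifferentiable_comp_dbl {f : ℍ → ℂ} (hf : MDiff f) : MDiff (fun τ => f (dbl τ)) := by
  rw [UpperHalfPlane.mdifferentiable_iff] at hf ⊢
  refine (hf.comp (f := fun z => 2 * z) (s := {z | 0 < z.im}) (by fun_prop)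
    fun z hz => by simpa using hz).congr fun z hz => ?_
  have hz2 : 0 < (2 * z).im := by simpa using hz
  simp only [Function.comp, ofComplex_apply_of_im_pos hz2]
  rw [ofComplex_apply_of_im_pos hz]
  rfl

lemma mdifferentiable_div {f g : ℍ → ℂ} (hf : MDiff f) (hg : MDiff g) (h0 : ∀ τ, g τ ≠ 0) :
    MDiff (fun τ => f τ / g τ) := by
  rw [UpperHalfPlane.mdifferentiable_iff] at *
  exact hf.div hg fun z _ => h0 _

lemma coe_smul_SL (γ : SL(2, ℤ)) (τ : ℍ) :
    ((γ • τ : ℍ) : ℂ) = (γ 0 0 * τ + γ 0 1) / (γ 1 0 * τ + γ 1 1) := by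
  rw [coe_specialLinearGroup_apply]
  simp

lemma denom_SL (γ : SL(2, ℤ)) (τ : ℍ) : denom γ τ = γ 1 0 * τ + γ 1 1 := by
  rw [ModularGroup.denom_apply]

/-- Conjugation by `diag(2, 1)` keeps `γ` integral when `c` is even. -/
lemma dbl_smul_of_even {γ : SL(2, ℤ)} (hc : γ 1 0 % 2 = 0) : ∃ γ' : SL(2, ℤ),
    γ' 0 1 = 2 * γ 0 1 ∧ γ 1 0 = 2 * γ' 1 0 ∧
    ∀ τ, dbl (γ • τ) = γ' • dbl τ ∧ denom γ' (dbl τ) = denom γ τ := by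
  obtain ⟨c, hc⟩ : ∃ c, γ 1 0 = 2 * c := ⟨γ 1 0 / 2, by omega⟩
  have hdet := det_eq γ
  let γ' : SL(2, ℤ) := ⟨!![γ 0 0, 2 * γ 0 1; c, γ 1 1], by
    rw [Matrix.det_fin_two_of]; linear_combination hdet + γ 0 1 * hc⟩
  refine ⟨γ', rfl, hc, fun τ => ?_⟩
  have hden : denom γ' (dbl τ) = denom γ τ := by
    rw [denom_SL, denom_SL, hc, coe_dbl]
    simp [γ']
    ring
  refine ⟨?_, hden⟩
  ext
  rw [coe_smul_SL, ← denom_SL, hden, coe_dbl, coe_dbl, coe_smul_SL, denom_SL]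
  simp [γ']
  ring

/-- This is the factorization `diag(2, 1) γ = γ' (1 j; 0 2)`, with `j ∈ {0, 1}` chosen so that `d -
cj` is even. The clause on `γ 1 1` pins down `x = 0` for `γ = S`. -/
lemma dbl_smul_of_odd {γ : SL(2, ℤ)} (hc : γ 1 0 % 2 = 1) : ∃ (γ' : SL(2, ℤ)) (x : ℝ),
    γ' 1 0 = γ 1 0 ∧ (γ 1 1 = 0 → x = 0) ∧
    ∀ τ, dbl (γ • τ) = γ' • half x τ ∧ denom γ' (half x τ) = denom γ τ / 2 := by
  have hdet := det_eq γ
  obtain ⟨j, hj, d, hd⟩ : ∃ j : ℤ, (γ 1 1 = 0 → j = 0) ∧ ∃ d, γ 1 1 = 2 * d + γ 1 0 * j := by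
    rcases Int.emod_two_eq_zero_or_one (γ 1 1) with h | h
    · exact ⟨0, fun _ => rfl, γ 1 1 / 2, by omega⟩
    · exact ⟨1, by omega, (γ 1 1 - γ 1 0) / 2, by omega⟩
  let γ' : SL(2, ℤ) := ⟨!![2 * γ 0 0, γ 0 1 - γ 0 0 * j; γ 1 0, d], by
    rw [Matrix.det_fin_two_of]; linear_combination hdet - γ 0 0 * hd⟩
  refine ⟨γ', j, rfl, fun h => by simp [hj h], fun τ => ?_⟩
  have hden : denom γ' (half j τ) = denom γ τ / 2 := by
    rw [denom_SL, denom_SL, hd, coe_half]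
    simp [γ']
    ring
  refine ⟨?_, hden⟩
  ext
  rw [coe_smul_SL, ← denom_SL, hden, coe_dbl, coe_half, coe_smul_SL, ← denom_SL]
  have := denom_ne_zero γ τ
  field_simp
  simp [γ']
  ring

/-! ### Sixth powers of `e23` and `e13` in terms of the discriminant. -/

lemma discriminant_smul (γ : SL(2, ℤ)) (τ : ℍ) :
    ModularForm.discriminant (γ • τ) = denom γ τ ^ 12 * ModularForm.discriminant τ := by
  have h := congrFun (SlashInvariantForm.slash_action_generators_SL2Z
    ModularForm.discriminant_S_invariant ModularForm.discriminant_T_invariant γ) τ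
  rw [ModularForm.SL_slash_apply] at h
  have hd : denom γ τ ≠ 0 := denom_ne_zero _ _
  rw [← h, mul_left_comm, zpow_neg, zpow_ofNat, mul_inv_cancel₀ (pow_ne_zero _ hd), mul_one]

lemma mdifferentiable_discriminant : MDiff ModularForm.discriminant :=
  CuspForm.discriminant.holo'

lemma tendsto_discriminant_div :
    Tendsto (fun τ : ℍ => ModularForm.discriminant τ / 𝕢 1 τ) atImInfty (𝓝 1) := by
  refine ModularForm.tendsto_atImInfty_tprod_one_sub_eta_q_pow.congr fun τ => ?_
  rw [ModularForm.discriminant_eq_q_prod,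
    mul_div_cancel_left₀ _ (Function.Periodic.qParam_ne_zero _)]

lemma qParam_pow (h : ℝ) (n : ℕ) (z : ℂ) : 𝕢 h z ^ n = cexp (2 * Real.pi * I * (n * z / h)) := by
  rw [Function.Periodic.qParam, ← Complex.exp_nat_mul]
  congr 1
  ring

lemma qParam_one_dbl (τ : ℍ) : 𝕢 1 (dbl τ) = 𝕢 1 τ ^ 2 := by
  rw [qParam_pow, ← pow_one (𝕢 1 (dbl τ)), qParam_pow, coe_dbl]
  simp

lemma qParam_two_sq (z : ℂ) : 𝕢 2 z ^ 2 = 𝕢 1 z := by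
  rw [qParam_pow, ← pow_one (𝕢 1 z), qParam_pow]
  congr 1
  push_cast
  ring

lemma qParam_two_dbl (τ : ℍ) : 𝕢 2 (dbl τ) = 𝕢 1 τ := by
  rw [← pow_one (𝕢 2 (dbl τ)), qParam_pow, ← pow_one (𝕢 1 τ), qParam_pow]
  congr 1
  simp [coe_dbl]

/-- The quotient of the two sides of the eta quotient formula for `e23 ^ 6`. -/
noncomputable def e23Quotient (τ : ℍ) : ℂ :=
  e23 τ ^ 6 * ModularForm.discriminant τ / ModularForm.discriminant (dbl τ) ^ 2

lemma tendsto_e23Quotient : Tendsto e23Quotient atImInfty (𝓝 (16 ^ 6)) := by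
  have h := (((tendsto_e23_div.pow 6).mul tendsto_discriminant_div).div
    ((tendsto_discriminant_div.comp tendsto_dbl).pow 2) (by norm_num))
  norm_num at h ⊢
  refine h.congr fun τ => ?_
  have h2 : 𝕢 2 τ ≠ 0 := Function.Periodic.qParam_ne_zero _
  have hD := ModularForm.discriminant_ne_zero (dbl τ)
  -- In the nome the orders of `e23⁶`, `Δ(τ)` and `Δ(2τ)²` are 6, 2 and 8, so the quotient has order
  -- 0.
  have h3 : 𝕢 1 (dbl τ) = 𝕢 2 τ ^ 4 := by rw [qParam_one_dbl, ← qParam_two_sq]; ring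
  simp only [← qParam_two_sq τ, h3, Pi.div_apply, e23Quotient]
  field_simp

lemma discriminant_isBigO :
    ModularForm.discriminant =O[atImInfty] fun τ : ℍ => Real.exp (-2 * Real.pi * τ.im) := by
  simpa using CuspFormClass.exp_decay_atImInfty (h := 1) CuspForm.discriminant one_pos
    one_mem_strictPeriods_SL

/-- Numerator and denominator both have exact size `exp(-2π Im τ)`; the lower bound for the
denominator is `exp_isBigO_discriminant`. -/
lemma isBounded_discriminant_div (x : ℝ) : IsBoundedAtImInfty fun τ : ℍ =>
    ModularForm.discriminant τ / ModularForm.discriminant (half x τ) ^ 2 := by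
  have h1 : ModularForm.discriminant =O[atImInfty]
      fun τ => ModularForm.discriminant (half x τ) ^ 2 := by
    refine discriminant_isBigO.trans ?_
    refine (((ModularForm.exp_isBigO_discriminant.comp_tendsto (tendsto_half x)).pow 2).congr_left
      fun τ => ?_)
    rw [Function.comp, ← Real.exp_nat_mul, ← coe_im, ← coe_im, coe_half]
    congr 1
    simp
    ring
  have h2 := h1.mul (Asymptotics.isBigO_refl (fun τ : ℍ =>
    (ModularForm.discriminant (half x τ) ^ 2)⁻¹) atImInfty)
  refine h2.trans (Asymptotics.IsBigO.of_bound 1 (Eventually.of_forall fun τ => ?_))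
  rw [mul_inv_cancel₀ (pow_ne_zero _ (ModularForm.discriminant_ne_zero _))]
  simp

lemma isBounded_of_tendsto {f : ℍ → ℂ} {c : ℂ} (h : Tendsto f atImInfty (𝓝 c)) :
    IsBoundedAtImInfty f := h.isBigO_one ℝ

lemma mdifferentiable_e23Quotient : MDiff e23Quotient :=
  mdifferentiable_div ((mdifferentiable_e23.pow 6).mul mdifferentiable_discriminant)
    ((mdifferentiable_comp_dbl mdifferentiable_discriminant).pow 2)
    fun _ => pow_ne_zero _ (ModularForm.discriminant_ne_zero _)

lemma e23Quotient_smul_of_even {γ : SL(2, ℤ)} (hc : γ 1 0 % 2 = 0) (τ : ℍ) :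
    e23Quotient (γ • τ) = e23Quotient τ := by
  obtain ⟨ε, hε, h⟩ := e23_smul_of_bot_even hc
  obtain ⟨γ', -, -, h'⟩ := dbl_smul_of_even hc
  have hd : denom γ τ ≠ 0 := denom_ne_zero _ _
  have hε6 : ε ^ 6 = 1 := by rw [pow_mul ε 2 3, hε, one_pow]
  rw [e23Quotient, h, (h' τ).1, discriminant_smul, discriminant_smul, (h' τ).2, e23Quotient]
  have hD := ModularForm.discriminant_ne_zero (dbl τ)
  simp only [mul_pow, hε6]
  field_simp

lemma e23Quotient_eq (τ : ℍ) : e23Quotient τ = 16 ^ 6 := by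
  have hmem : e23Quotient ∈ modularFormSpace 2 0 := by
    refine mem_modularFormSpace_of mdifferentiable_e23Quotient (fun γ hγ τ => ?_) fun γ => ?_
    · rw [zpow_zero, one_mul]
      refine e23Quotient_smul_of_even ?_ τ
      rw [CongruenceSubgroup.Gamma0_mem, ZMod.intCast_zmod_eq_zero_iff_dvd] at hγ
      exact Int.emod_eq_zero_of_dvd hγ
    · simp only [zpow_zero, one_mul]
      rcases Int.emod_two_eq_zero_or_one (γ 1 0) with hc | hc
      · exact ⟨e23Quotient, isBounded_of_tendsto tendsto_e23Quotient, e23Quotient_smul_of_even hc⟩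
      · obtain ⟨γ', x, -, -, h'⟩ := dbl_smul_of_odd hc
        obtain ⟨ε, hε, h⟩ := e23_smul_of_bot_odd hc
        have hε6 : ε ^ 6 = 1 := by rw [pow_mul ε 2 3, hε, one_pow]
        have key (f : ℍ → ℂ) (hf : Tendsto f atImInfty (𝓝 1))
            (h : ∀ τ, e23 (γ • τ) = denom γ τ ^ 2 * (ε * f τ)) :
            ∃ g, IsBoundedAtImInfty g ∧ ∀ τ, e23Quotient (γ • τ) = g τ := by
          -- The factor `2 ^ 24` comes from `denom γ τ / 2` raised to the power `2 * 12`.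
          refine ⟨fun τ => 2 ^ 24 * f τ ^ 6 *
            (ModularForm.discriminant τ / ModularForm.discriminant (half x τ) ^ 2), ?_,
            fun τ => ?_⟩
          · simpa using! (isBounded_of_tendsto ((hf.pow 6).const_mul (2 ^ 24))).mul
              (isBounded_discriminant_div x)
          · have hd : denom γ τ ≠ 0 := denom_ne_zero _ _
            rw [e23Quotient, h, (h' τ).1, discriminant_smul, discriminant_smul, (h' τ).2]
            have hD := ModularForm.discriminant_ne_zero (half x τ)
            simp only [mul_pow, hε6, div_pow]
            field_simp
        rcases h with h | h
        · exact key e13 tendsto_e13 h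
        · exact key e12 tendsto_e12 h
  obtain ⟨F, hF⟩ := hmem
  obtain ⟨c, hc⟩ := F.eq_const_of_weight_zero
  rw [hF] at hc
  have h := tendsto_e23Quotient
  rw [hc] at h ⊢
  exact tendsto_nhds_unique tendsto_const_nhds h

lemma e23_pow_six (τ : ℍ) : e23 τ ^ 6 * ModularForm.discriminant τ =
    16 ^ 6 * ModularForm.discriminant (dbl τ) ^ 2 := by
  have h := e23Quotient_eq τ
  rwa [e23Quotient, div_eq_iff (pow_ne_zero _ (ModularForm.discriminant_ne_zero _))] at h

/-- At `-1/τ`, doubling becomes halving, since `2(-1/τ) = -1/(τ/2)`. The constant `16⁶ = 2²⁴`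
cancels against the factor `(τ/2)²⁴`. -/
lemma e13_pow_six (τ : ℍ) : e13 τ ^ 6 * ModularForm.discriminant τ =
    ModularForm.discriminant (half 0 τ) ^ 2 := by
  have h := e23_pow_six (ModularGroup.S • τ)
  have hS1 : ModularGroup.S 1 0 = 1 := rfl
  have hS2 : ModularGroup.S 1 1 = 0 := rfl
  obtain ⟨γ', x, -, hx, h'⟩ := dbl_smul_of_odd (γ := ModularGroup.S) (by rw [hS1]; rfl)
  rw [hx hS2] at h'
  rw [(h' τ).1, discriminant_smul, discriminant_smul, (h' τ).2, e23_S_smul,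
    ModularGroup.denom_S] at h
  have hτ : (τ : ℂ) ≠ 0 := τ.ne_zero
  have hτ24 : (τ : ℂ) ^ 24 ≠ 0 := pow_ne_zero _ hτ
  apply mul_left_cancel₀ hτ24
  linear_combination h

lemma e23_ne_zero (τ : ℍ) : e23 τ ≠ 0 := fun h => by
  have := e23_pow_six τ
  rw [h, zero_pow (by norm_num), zero_mul] at this
  exact mul_ne_zero (by norm_num) (pow_ne_zero _ (ModularForm.discriminant_ne_zero _)) this.symm

lemma e13_ne_zero (τ : ℍ) : e13 τ ≠ 0 := fun h => by
  have := e13_pow_six τ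
  rw [h, zero_pow (by norm_num), zero_mul] at this
  exact pow_ne_zero _ (ModularForm.discriminant_ne_zero _) this.symm

/-! ### Extracting sixth roots: the eta quotients. -/

/-- A continuous map from the connected space `ℍ` to the finite set of `n`-th roots of unity is
constant, and the limit identifies the constant. -/
lemma eq_one_of_pow_eq_one {f : ℍ → ℂ} (hf : Continuous f) {n : ℕ} (hn : n ≠ 0)
    (h : ∀ τ, f τ ^ n = 1) (hlim : Tendsto f atImInfty (𝓝 1)) (τ : ℍ) : f τ = 1 := by
  have hfin : {z : ℂ | z ^ n = 1}.Finite := by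
    refine (Polynomial.nthRootsFinset n (1 : ℂ)).finite_toSet.subset fun z hz => ?_
    exact (Polynomial.mem_nthRootsFinset (Nat.pos_of_ne_zero hn) _).2 hz
  obtain ⟨c, -, hc⟩ := isPreconnected_univ.eqOn_const_of_mapsTo hfin.isDiscrete hf.continuousOn
    (fun σ _ => h σ) ⟨1, by simp⟩
  have hc' : f = fun _ => c := funext fun σ => hc (Set.mem_univ σ)
  rw [hc'] at hlim ⊢
  exact tendsto_nhds_unique tendsto_const_nhds hlim

/-- The infinite product `∏ (1 - qⁿ)`. -/
noncomputable def eulerProd (q : ℂ) : ℂ := ∏' n : ℕ, (1 - q ^ (n + 1))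

lemma eta_eq (z : ℂ) : ModularForm.eta z = 𝕢 24 z * eulerProd (𝕢 1 z) := rfl

lemma tendsto_eulerProd : Tendsto (fun τ : ℍ => eulerProd (𝕢 1 τ)) atImInfty (𝓝 1) := by
  have h := ((ModularForm.differentiableOn_tprod_one_sub_pow.differentiableAt
    (Metric.ball_mem_nhds 0 one_pos)).continuousAt.tendsto).comp
    (qParam_tendsto_atImInfty one_pos)
  simpa [Function.comp_def, eulerProd] using h

lemma eta_ne_zero (τ : ℍ) : ModularForm.eta τ ≠ 0 := ModularForm.eta_ne_zero τ.2

lemma continuous_eta : Continuous fun τ : ℍ => ModularForm.eta τ := by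
  refine continuous_iff_continuousAt.2 fun τ => ?_
  exact (ModularForm.differentiableAt_eta_of_mem_upperHalfPlaneSet τ.2).continuousAt.comp
    continuous_coe.continuousAt

lemma continuous_dbl : Continuous dbl :=
  isEmbedding_coe.continuous_iff.2 (by
    change Continuous fun τ : ℍ => (2 : ℂ) * τ
    exact continuous_const.mul continuous_coe)

lemma e13_dbl_eq (τ : ℍ) :
    e13 (dbl τ) = ModularForm.eta τ ^ 8 / ModularForm.eta (dbl τ) ^ 4 := by
  have h1 := eta_ne_zero
  rw [eq_div_iff (pow_ne_zero _ (h1 _)), ← div_eq_one_iff_eq (pow_ne_zero _ (h1 _))]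
  refine eq_one_of_pow_eq_one (n := 6)
    (f := fun τ => e13 (dbl τ) * ModularForm.eta (dbl τ) ^ 4 / ModularForm.eta τ ^ 8) ?_
    (by norm_num) (fun τ => ?_) ?_ τ
  · exact ((mdifferentiable_e13.continuous.comp continuous_dbl).mul
      ((continuous_eta.comp continuous_dbl).pow 4)).div (continuous_eta.pow 8)
      fun τ => pow_ne_zero _ (h1 τ)
  · have h := e13_pow_six (dbl τ)
    rw [half_zero_dbl, ModularForm.discriminant, ModularForm.discriminant] at h
    rw [div_pow, mul_pow, ← pow_mul, ← pow_mul, h, ← pow_mul]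
    exact div_self (pow_ne_zero _ (h1 τ))
  · have h := ((tendsto_e13.comp tendsto_dbl).mul ((tendsto_eulerProd.comp tendsto_dbl).pow 4)).div
      (tendsto_eulerProd.pow 8) (by norm_num)
    norm_num at h
    refine h.congr fun τ => ?_
    -- The fractional powers of `q` in the eta functions cancel, leaving Euler products that tend to
    -- 1.
    have h24 : 𝕢 24 (dbl τ) ^ 4 = 𝕢 24 τ ^ 8 := by
      rw [qParam_pow, qParam_pow, coe_dbl]
      congr 1
      push_cast
      ring
    have h0 : 𝕢 24 τ ≠ 0 := Function.Periodic.qParam_ne_zero _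
    simp only [Pi.div_apply, eta_eq, mul_pow, h24]
    field_simp

lemma eta_dbl_dbl_eq (τ : ℍ) :
    ModularForm.eta (dbl (dbl τ)) ^ 8 / ModularForm.eta (dbl τ) ^ 4 = -(1 / 16) * e23 (dbl τ) := by
  have h1 := eta_ne_zero
  have h2 : ∀ τ, -(1 / 16) * e23 (dbl τ) ≠ 0 := fun τ => mul_ne_zero (by norm_num) (e23_ne_zero _)
  rw [← div_eq_one_iff_eq (h2 τ)]
  refine eq_one_of_pow_eq_one (n := 6) (f := fun τ => ModularForm.eta (dbl (dbl τ)) ^ 8 /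
    ModularForm.eta (dbl τ) ^ 4 / (-(1 / 16) * e23 (dbl τ))) ?_ (by norm_num) (fun τ => ?_) ?_ τ
  · exact (((continuous_eta.comp (continuous_dbl.comp continuous_dbl)).pow 8).div
      ((continuous_eta.comp continuous_dbl).pow 4) fun τ => pow_ne_zero _ (h1 _)).div
      (continuous_const.mul (mdifferentiable_e23.continuous.comp continuous_dbl)) h2
  · have h := e23_pow_six (dbl τ)
    rw [ModularForm.discriminant, ModularForm.discriminant] at h
    have h3 := h1 (dbl τ)
    have h4 := e23_ne_zero (dbl τ)
    field_simp
    linear_combination -h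
  · have h := (((tendsto_eulerProd.comp (tendsto_dbl.comp tendsto_dbl)).pow 8).div
      ((tendsto_eulerProd.comp tendsto_dbl).pow 4) (by norm_num)).div
      ((tendsto_e23_div.comp tendsto_dbl).const_mul (-(1 / 16))) (by norm_num)
    norm_num at h
    refine h.congr fun τ => ?_
    have h24 : 𝕢 24 (dbl (dbl τ)) ^ 8 = 𝕢 24 (dbl τ) ^ 4 * 𝕢 2 (dbl τ) := by
      rw [qParam_pow, qParam_pow, ← pow_one (𝕢 2 _), qParam_pow, ← Complex.exp_add]
      congr 1
      push_cast [coe_dbl]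
      ring
    have h0 : 𝕢 24 (dbl τ) ≠ 0 := Function.Periodic.qParam_ne_zero _
    have h0' : 𝕢 2 (dbl τ) ≠ 0 := Function.Periodic.qParam_ne_zero _
    simp only [Pi.div_apply, eta_eq, mul_pow, h24]
    field_simp

/-! ### `E24` and `Delta4` as forms of weight 2 on `Γ₀(4)`. -/

lemma E24_eq_e13 (τ : ℍ) : E24 τ = e13 (dbl τ) := by
  rw [← wpTilde_half_self, coe_dbl, mul_div_cancel_left₀ _ two_ne_zero, E24]

lemma Delta4_eq_e23 (τ : ℍ) : Delta4 τ = -(1 / 16) * e23 (dbl τ) := by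
  rw [← eta_dbl_dbl_eq, Delta4, coe_dbl, coe_dbl]
  ring_nf

lemma emod_four_of_mem_Gamma0 {γ : SL(2, ℤ)} :
    γ ∈ CongruenceSubgroup.Gamma0 4 ↔ γ 1 0 % 4 = 0 := by
  rw [CongruenceSubgroup.Gamma0_mem, ZMod.intCast_zmod_eq_zero_iff_dvd]
  exact Int.dvd_iff_emod_eq_zero

/-- Doubling conjugates `Γ₀(4)` into matrices with even off-diagonal entries, which fix each half
period modulo the lattice. -/
lemma exists_dbl_smul_of_Gamma0 {γ : SL(2, ℤ)} (h : γ ∈ CongruenceSubgroup.Gamma0 4) :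
    ∃ γ' : SL(2, ℤ), γ' 0 1 % 2 = 0 ∧ γ' 1 0 % 2 = 0 ∧
      ∀ τ, dbl (γ • τ) = γ' • dbl τ ∧ denom γ' (dbl τ) = denom γ τ := by
  rw [emod_four_of_mem_Gamma0] at h
  obtain ⟨γ', h1, h2, h3⟩ := dbl_smul_of_even (γ := γ) (by omega)
  exact ⟨γ', by omega, by omega, h3⟩

/-- The map `τ ↦ 2τ` intertwines the action of `γ` on `ℍ` with that of some `γ'` after an
affine change of variable fixing the cusp `i∞`. -/
lemma exists_dbl_smul (γ : SL(2, ℤ)) : ∃ (γ' : SL(2, ℤ)) (φ : ℍ → ℍ) (κ : ℂ), κ ≠ 0 ∧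
    Tendsto φ atImInfty atImInfty ∧ (γ 1 0 % 4 ≠ 0 → γ' 1 0 % 2 = 1) ∧
    ∀ τ, dbl (γ • τ) = γ' • φ τ ∧ denom γ' (φ τ) = κ * denom γ τ := by
  rcases Int.emod_two_eq_zero_or_one (γ 1 0) with hc | hc
  · obtain ⟨γ', -, h2, h3⟩ := dbl_smul_of_even hc
    exact ⟨γ', dbl, 1, one_ne_zero, tendsto_dbl, by omega, fun τ => by simpa using h3 τ⟩
  · obtain ⟨γ', x, h2, -, h3⟩ := dbl_smul_of_odd hc
    refine ⟨γ', half x, 1 / 2, by norm_num, tendsto_half x, by omega, fun τ => ⟨(h3 τ).1, ?_⟩⟩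
    rw [(h3 τ).2]
    ring

lemma exists_tendsto_comp_dbl_smul {f : ℍ → ℂ} {γ γ' : SL(2, ℤ)} {φ : ℍ → ℍ} {κ : ℂ}
    (hφ : Tendsto φ atImInfty atImInfty)
    (h : ∀ τ, dbl (γ • τ) = γ' • φ τ ∧ denom γ' (φ τ) = κ * denom γ τ) {X : ℍ → ℂ} {c ε : ℂ}
    (hX : Tendsto X atImInfty (𝓝 c)) (hf : ∀ τ, f (γ' • τ) = denom γ' τ ^ 2 * (ε * X τ)) :
    ∃ g : ℍ → ℂ, Tendsto g atImInfty (𝓝 (κ ^ 2 * ε * c)) ∧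
      ∀ τ, f (dbl (γ • τ)) = denom γ τ ^ (2 : ℤ) * g τ := by
  refine ⟨fun τ => κ ^ 2 * ε * X (φ τ), (hX.comp hφ).const_mul _, fun τ => ?_⟩
  rw [(h τ).1, hf, (h τ).2, zpow_ofNat]
  ring

lemma E24_mem : E24 ∈ modularFormSpace 4 2 := by
  have hE : E24 = fun τ => e13 (dbl τ) := funext E24_eq_e13
  rw [hE]
  refine mem_modularFormSpace_of (mdifferentiable_comp_dbl mdifferentiable_e13)
    (fun γ hγ τ => ?_) fun γ => ?_
  · obtain ⟨γ', hb, hc, h⟩ := exists_dbl_smul_of_Gamma0 hγ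
    rw [(h τ).1, e13_smul_of_even hb hc, (h τ).2, zpow_ofNat]
  · obtain ⟨γ', φ, κ, -, hφ, -, h⟩ := exists_dbl_smul γ
    obtain ⟨ε, -, h' | h' | h'⟩ := e13_smul_cases γ'
    · obtain ⟨g, hg, hg'⟩ := exists_tendsto_comp_dbl_smul hφ h tendsto_e13 h'
      exact ⟨g, isBounded_of_tendsto hg, hg'⟩
    · obtain ⟨g, hg, hg'⟩ := exists_tendsto_comp_dbl_smul hφ h tendsto_e12 h'
      exact ⟨g, isBounded_of_tendsto hg, hg'⟩
    · obtain ⟨g, hg, hg'⟩ := exists_tendsto_comp_dbl_smul hφ h tendsto_e23 h'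
      exact ⟨g, isBounded_of_tendsto hg, hg'⟩

lemma Delta4_eq : Delta4 = fun τ => -(1 / 16) * e23 (dbl τ) := funext Delta4_eq_e23

lemma Delta4_ne_zero (τ : ℍ) : Delta4 τ ≠ 0 := by
  rw [Delta4_eq_e23]
  exact mul_ne_zero (by norm_num) (e23_ne_zero _)

lemma E24_ne_zero (τ : ℍ) : E24 τ ≠ 0 := by
  rw [E24_eq_e13]
  exact e13_ne_zero _

lemma mdifferentiable_Delta4 : MDiff Delta4 := by
  rw [Delta4_eq]
  exact (mdifferentiable_comp_dbl mdifferentiable_e23).const_smul (-(1 / 16) : ℂ)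

lemma Delta4_smul {γ : SL(2, ℤ)} (hγ : γ ∈ CongruenceSubgroup.Gamma0 4) (τ : ℍ) :
    Delta4 (γ • τ) = denom γ τ ^ (2 : ℤ) * Delta4 τ := by
  obtain ⟨γ', hb, hc, h⟩ := exists_dbl_smul_of_Gamma0 hγ
  rw [Delta4_eq_e23, (h τ).1, e23_smul_of_even hb hc, (h τ).2, zpow_ofNat, Delta4_eq_e23]
  ring

/-- The cusp `γ∞` is equivalent to `∞` exactly when `4 ∣ c`, so this says that `Delta4` does not
vanish at the other cusps. -/
lemma Delta4_smul_of_notMem {γ : SL(2, ℤ)} (hγ : γ ∉ CongruenceSubgroup.Gamma0 4) :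
    ∃ (g : ℍ → ℂ) (c : ℂ), c ≠ 0 ∧ Tendsto g atImInfty (𝓝 c) ∧
      ∀ τ, Delta4 (γ • τ) = denom γ τ ^ (2 : ℤ) * g τ := by
  rw [emod_four_of_mem_Gamma0] at hγ
  obtain ⟨γ', φ, κ, hκ, hφ, hc, h⟩ := exists_dbl_smul γ
  obtain ⟨ε, hε, h'⟩ := e23_smul_of_bot_odd (hc hγ)
  have hε0 : ε ≠ 0 := fun h0 => by simp [h0] at hε
  obtain ⟨g, hg, hg'⟩ : ∃ g : ℍ → ℂ, Tendsto g atImInfty (𝓝 (κ ^ 2 * ε * 1)) ∧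
      ∀ τ, e23 (dbl (γ • τ)) = denom γ τ ^ (2 : ℤ) * g τ := by
    rcases h' with h' | h'
    · exact exists_tendsto_comp_dbl_smul hφ h tendsto_e13 h'
    · exact exists_tendsto_comp_dbl_smul hφ h tendsto_e12 h'
  refine ⟨fun τ => -(1 / 16) * g τ, -(1 / 16) * (κ ^ 2 * ε * 1), ?_, hg.const_mul _, fun τ => ?_⟩
  · simp [hκ, hε0]
  · rw [Delta4_eq_e23, hg']
    ring

lemma tendsto_E24 : Tendsto E24 atImInfty (𝓝 1) := by
  rw [funext E24_eq_e13]
  exact tendsto_e13.comp tendsto_dbl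

lemma tendsto_Delta4_div : Tendsto (fun τ : ℍ => Delta4 τ / 𝕢 1 τ) atImInfty (𝓝 1) := by
  have h := (tendsto_e23_div.comp tendsto_dbl).const_mul (-(1 / 16))
  norm_num at h
  refine h.congr fun τ => ?_
  rw [Delta4_eq_e23, qParam_two_dbl]
  ring

lemma tendsto_Delta4 : Tendsto Delta4 atImInfty (𝓝 0) := by
  have h := tendsto_Delta4_div.mul (qParam_tendsto_atImInfty one_pos)
  rw [mul_zero] at h
  exact h.congr fun τ => div_mul_cancel₀ _ (Function.Periodic.qParam_ne_zero _)

lemma Delta4_mem : Delta4 ∈ modularFormSpace 4 2 := by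
  refine mem_modularFormSpace_of mdifferentiable_Delta4 (fun γ hγ τ => Delta4_smul hγ τ)
    fun γ => ?_
  by_cases hγ : γ ∈ CongruenceSubgroup.Gamma0 4
  · exact ⟨Delta4, isBounded_of_tendsto tendsto_Delta4, Delta4_smul hγ⟩
  · obtain ⟨g, c, -, hg, h⟩ := Delta4_smul_of_notMem hγ
    exact ⟨g, isBounded_of_tendsto hg, h⟩

/-! ### Behaviour at `∞` and the first `q`-coefficients. -/

section qExpansion

variable {N : ℕ} {k : ℤ} {f : ℍ → ℂ}

lemma isBounded_of_mem [NeZero N] (hf : f ∈ modularFormSpace N k) : IsBoundedAtImInfty f := by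
  obtain ⟨g, hg, h⟩ := exists_bounded_of_mem hf 1
  have : f = g := funext fun τ => by simpa using h τ
  rwa [this]

lemma periodic_of_mem (hf : f ∈ modularFormSpace N k) :
    Function.Periodic (f ∘ ofComplex) (1 : ℝ) := by
  obtain ⟨g, rfl⟩ := hf
  exact SlashInvariantFormClass.periodic_comp_ofComplex g (by simp)

lemma analyticAt_cuspFunction_of_mem [NeZero N] (hf : f ∈ modularFormSpace N k) :
    AnalyticAt ℂ (cuspFunction 1 f) 0 :=
  analyticAt_cuspFunction_zero one_pos (periodic_of_mem hf) (mdifferentiable_of_mem hf)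
    (isBounded_of_mem hf)

lemma tendsto_cuspFunction_of_mem [NeZero N] (hf : f ∈ modularFormSpace N k) :
    Tendsto f atImInfty (𝓝 (cuspFunction 1 f 0)) := by
  refine ((analyticAt_cuspFunction_of_mem hf).continuousAt.tendsto.comp
    (qParam_tendsto_atImInfty one_pos)).congr fun τ => ?_
  exact eq_cuspFunction τ one_ne_zero (periodic_of_mem hf)

lemma coeff_zero_qExpansion_of_tendsto [NeZero N] (hf : f ∈ modularFormSpace N k) {c : ℂ}
    (h : Tendsto f atImInfty (𝓝 c)) : (qExpansion 1 f).coeff 0 = c := by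
  simpa [qExpansion_coeff] using tendsto_nhds_unique (tendsto_cuspFunction_of_mem hf) h

/-- The coefficient is the derivative of the cusp function at 0, and `f / q` is its difference
quotient. -/
lemma coeff_one_qExpansion_of_tendsto [NeZero N] (hf : f ∈ modularFormSpace N k) {c : ℂ}
    (h0 : Tendsto f atImInfty (𝓝 0))
    (h : Tendsto (fun τ : ℍ => f τ / 𝕢 1 τ) atImInfty (𝓝 c)) :
    (qExpansion 1 f).coeff 1 = c := by
  have hz := tendsto_nhds_unique (tendsto_cuspFunction_of_mem hf) h0
  have hd := (analyticAt_cuspFunction_of_mem hf).differentiableAt.hasDerivAt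
  rw [hasDerivAt_iff_tendsto_slope] at hd
  have hq : Tendsto (fun τ : ℍ => 𝕢 1 τ) atImInfty (𝓝[≠] 0) :=
    tendsto_nhdsWithin_iff.2 ⟨qParam_tendsto_atImInfty one_pos,
      Eventually.of_forall fun τ => Function.Periodic.qParam_ne_zero _⟩
  have h2 := tendsto_nhds_unique ((hd.comp hq).congr fun τ => ?_) h
  · simpa [qExpansion_coeff] using h2
  · rw [Function.comp, slope_def_field, hz, eq_cuspFunction τ one_ne_zero (periodic_of_mem hf),
      sub_zero, sub_zero]

lemma isBounded_div_qParam_of_mem [NeZero N] (hf : f ∈ modularFormSpace N k)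
    (h0 : Tendsto f atImInfty (𝓝 0)) : IsBoundedAtImInfty fun τ => f τ / 𝕢 1 τ := by
  have h := IsZeroAtImInfty.exp_decay_atImInfty h0 one_pos (periodic_of_mem hf)
    (mdifferentiable_of_mem hf) (isBounded_of_mem hf)
  have h1 : f =O[atImInfty] fun τ : ℍ => 𝕢 1 τ := by
    refine h.trans (Asymptotics.IsBigO.of_bound 1 (Eventually.of_forall fun τ => ?_))
    rw [Function.Periodic.norm_qParam, one_mul, Real.norm_of_nonneg (Real.exp_pos _).le]
    simp
  have h2 := h1.mul (Asymptotics.isBigO_refl (fun τ : ℍ => (𝕢 1 τ)⁻¹) atImInfty)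
  refine h2.trans (Asymptotics.IsBigO.of_bound 1 (Eventually.of_forall fun τ => ?_))
  rw [mul_inv_cancel₀ (Function.Periodic.qParam_ne_zero _)]
  simp

end qExpansion

/-! ### Division by `Delta4` and generation by `E24` and `Delta4`. -/

/-- `Delta4` has no zero on `ℍ`, a simple zero at `∞` compensated by that of `f`, and a nonzero
limit at every other cusp, so the quotient is holomorphic and bounded at all cusps. -/
lemma div_Delta4_mem {k : ℤ} {f : ℍ → ℂ} (hf : f ∈ modularFormSpace 4 k)
    (h0 : Tendsto f atImInfty (𝓝 0)) :
    (fun τ => f τ / Delta4 τ) ∈ modularFormSpace 4 (k - 2) := by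
  have inv : ∀ γ ∈ CongruenceSubgroup.Gamma0 4, ∀ τ : ℍ,
      f (γ • τ) / Delta4 (γ • τ) = denom γ τ ^ (k - 2) * (f τ / Delta4 τ) := by
    intro γ hγ τ
    have hd := denom_ne_zero γ τ
    rw [smul_eq_of_mem hf hγ, Delta4_smul hγ, zpow_sub₀ hd]
    ring
  refine mem_modularFormSpace_of (mdifferentiable_div (mdifferentiable_of_mem hf)
    mdifferentiable_Delta4 Delta4_ne_zero) inv fun γ => ?_
  by_cases hγ : γ ∈ CongruenceSubgroup.Gamma0 4
  · refine ⟨_, ?_, inv γ hγ⟩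
    have h1 := isBounded_div_qParam_of_mem hf h0
    have h2 := isBounded_of_tendsto (tendsto_Delta4_div.inv₀ one_ne_zero)
    refine (h1.mul h2 :).congr (fun τ => ?_) fun τ => ?_
    · have := Function.Periodic.qParam_ne_zero (h := 1) (τ : ℂ)
      have := Delta4_ne_zero τ
      rw [Pi.mul_apply]
      field_simp
    · simp
  · obtain ⟨g, hg, h⟩ := exists_bounded_of_mem hf γ
    obtain ⟨D, c, hc, hD, h'⟩ := Delta4_smul_of_notMem hγ
    refine ⟨fun τ => g τ * (D τ)⁻¹, ?_, fun τ => ?_⟩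
    · refine (hg.mul (isBounded_of_tendsto (hD.inv₀ hc)) :).congr_right fun τ => ?_
      simp
    · have hd := denom_ne_zero γ τ
      rw [h, h', zpow_sub₀ hd]
      ring

lemma mul_mem_modularFormSpace {N : ℕ} [NeZero N] {j k : ℤ} {f g : ℍ → ℂ}
    (hf : f ∈ modularFormSpace N j) (hg : g ∈ modularFormSpace N k) :
    f * g ∈ modularFormSpace N (j + k) := by
  obtain ⟨f, rfl⟩ := hf
  obtain ⟨g, rfl⟩ := hg
  exact ⟨f.mul g, rfl⟩

lemma one_mem_modularFormSpace (N : ℕ) [NeZero N] : (1 : ℍ → ℂ) ∈ modularFormSpace N 0 :=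
  ⟨1, rfl⟩

lemma pow_mem_modularFormSpace {N : ℕ} [NeZero N] {k : ℤ} {f : ℍ → ℂ}
    (hf : f ∈ modularFormSpace N k) (n : ℕ) : f ^ n ∈ modularFormSpace N (k * n) := by
  induction n with
  | zero => simpa using one_mem_modularFormSpace N
  | succ n ih =>
    rw [pow_succ, show k * ((n + 1 : ℕ) : ℤ) = k * n + k by push_cast; ring]
    exact mul_mem_modularFormSpace ih hf

lemma monomial_mem (a b : ℕ) :
    E24 ^ a * Delta4 ^ b ∈ modularFormSpace 4 (2 * ((a + b : ℕ) : ℤ)) := by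
  rw [show 2 * ((a + b : ℕ) : ℤ) = 2 * a + 2 * b by push_cast; ring]
  exact mul_mem_modularFormSpace (pow_mem_modularFormSpace E24_mem a)
    (pow_mem_modularFormSpace Delta4_mem b)

lemma tendsto_E24_pow (k : ℕ) : Tendsto (E24 ^ k) atImInfty (𝓝 1) := by
  have h := tendsto_E24.pow k
  rw [one_pow] at h
  exact h

/-- Subtracting a multiple of `E24 ^ k` from a form of weight `2k` and dividing by `Delta4`. -/
lemma exists_eq_add_Delta4_mul {k : ℕ} {f : ℍ → ℂ} (hf : f ∈ modularFormSpace 4 (2 * (k : ℤ))) :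
    ∃ (c : ℂ) (g : ℍ → ℂ), g ∈ modularFormSpace 4 (2 * (k : ℤ) - 2) ∧
      f = c • E24 ^ k + Delta4 * g := by
  have hE : E24 ^ k ∈ modularFormSpace 4 (2 * (k : ℤ)) := pow_mem_modularFormSpace E24_mem k
  set c := cuspFunction 1 f 0
  have h0 : Tendsto (f - c • E24 ^ k) atImInfty (𝓝 0) := by
    have h := (tendsto_cuspFunction_of_mem hf).sub ((tendsto_E24_pow k).const_mul c)
    rw [mul_one, sub_self] at h
    exact h
  refine ⟨c, _, div_Delta4_mem (Submodule.sub_mem _ hf (Submodule.smul_mem _ c hE)) h0, ?_⟩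
  ext τ
  have := Delta4_ne_zero τ
  simp only [Pi.add_apply, Pi.sub_apply, Pi.mul_apply]
  field_simp
  ring

lemma eq_const_of_mem_zero {f : ℍ → ℂ} (hf : f ∈ modularFormSpace 4 0) :
    ∃ c : ℂ, f = fun _ => c := by
  obtain ⟨F, rfl⟩ := hf
  exact F.eq_const_of_weight_zero

lemma mem_iff_exists_isHomogeneous (k : ℕ) (f : ℍ → ℂ) :
    f ∈ modularFormSpace 4 (2 * (k : ℤ)) ↔ ∃ P : MvPolynomial (Fin 2) ℂ, P.IsHomogeneous k ∧
      f = MvPolynomial.aeval ![E24, Delta4] P := by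
  constructor
  -- The descent ends in weight 0, where every form is constant.
  · induction k generalizing f with
    | zero =>
      intro hf
      obtain ⟨c, rfl⟩ := eq_const_of_mem_zero (by simpa using hf)
      refine ⟨MvPolynomial.C c, MvPolynomial.isHomogeneous_C _ _, ?_⟩
      rw [MvPolynomial.aeval_C]
      rfl
    | succ k ih =>
      intro hf
      obtain ⟨c, g, hg, rfl⟩ := exists_eq_add_Delta4_mul hf
      obtain ⟨Q, hQ, rfl⟩ := ih g (by convert hg using 2; push_cast; ring)
      refine ⟨MvPolynomial.C c * MvPolynomial.X 0 ^ (k + 1) + MvPolynomial.X 1 * Q,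
        .add (MvPolynomial.IsHomogeneous.C_mul (MvPolynomial.isHomogeneous_X_pow _ _) c) ?_, ?_⟩
      · rw [add_comm k 1]
        exact (MvPolynomial.isHomogeneous_X _ _).mul hQ
      · simp [Algebra.smul_def]
  · rintro ⟨P, hP, rfl⟩
    rw [P.as_sum, map_sum]
    refine Submodule.sum_mem _ fun m hm => ?_
    have hdeg : k = m 0 + m 1 := by
      have := hP (MvPolynomial.mem_support_iff.1 hm)
      rw [← this, Finsupp.weight_apply, Finsupp.sum_fintype _ _ (by simp), Fin.sum_univ_two]
      simp
    rw [MvPolynomial.aeval_monomial, ← Algebra.smul_def, hdeg]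
    refine Submodule.smul_mem _ _ ?_
    rw [Finsupp.prod_fintype _ _ (by simp), Fin.prod_univ_two]
    exact monomial_mem _ _

/-! ### Linear independence and the monomial basis. -/

/-- A finite range would be closed and contain the limit 0, but the quotient never vanishes. -/
lemma infinite_range_div : (Set.range fun τ => Delta4 τ / E24 τ).Infinite := by
  intro hfin
  have h : Tendsto (fun τ => Delta4 τ / E24 τ) atImInfty (𝓝 0) := by
    have h := tendsto_Delta4.div tendsto_E24 one_ne_zero
    rw [zero_div] at h
    exact h
  obtain ⟨τ, hτ⟩ := hfin.isClosed.mem_of_tendsto h (Eventually.of_forall fun τ => ⟨τ, rfl⟩)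
  exact div_ne_zero (Delta4_ne_zero τ) (E24_ne_zero τ) hτ

/-- Divided by `E24 ^ k`, a linear relation becomes a polynomial in one variable vanishing at all
values of `Delta4 / E24`. -/
lemma linearIndependent_monomials (k : ℕ) :
    LinearIndependent ℂ fun i : Fin (k + 1) => E24 ^ (k - i : ℕ) * Delta4 ^ (i : ℕ) := by
  rw [Fintype.linearIndependent_iff]
  intro c hc i
  let p : Polynomial ℂ := ∑ j : Fin (k + 1), Polynomial.monomial (j : ℕ) (c j)
  have hp : p = 0 := by
    refine Polynomial.eq_zero_of_infinite_isRoot p (infinite_range_div.mono ?_)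
    rintro _ ⟨τ, rfl⟩
    have hτ := congrFun hc τ
    have hE := E24_ne_zero τ
    rw [Set.mem_ofPred_eq, Polynomial.IsRoot, Polynomial.eval_finsetSum]
    simp only [Finset.sum_apply, Pi.smul_apply, Pi.mul_apply, Pi.pow_apply, smul_eq_mul,
      Pi.zero_apply] at hτ
    rw [← mul_right_inj' (pow_ne_zero k hE), mul_zero, ← hτ, Finset.mul_sum]
    refine Finset.sum_congr rfl fun j _ => ?_
    have hk : E24 τ ^ k = E24 τ ^ (k - j : ℕ) * E24 τ ^ (j : ℕ) := by
      rw [← pow_add]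
      congr 1
      omega
    rw [Polynomial.eval_monomial, div_pow, hk]
    field_simp
  have := congrArg (Polynomial.coeff · i) hp
  simpa [p, Polynomial.finsetSum_coeff, Polynomial.coeff_monomial, Fin.val_inj] using this

lemma span_monomials (k : ℕ) :
    modularFormSpace 4 (2 * (k : ℤ)) ≤
      Submodule.span ℂ (Set.range fun i : Fin (k + 1) => E24 ^ (k - i : ℕ) * Delta4 ^ (i : ℕ)) := by
  intro f hf
  obtain ⟨P, hP, rfl⟩ := (mem_iff_exists_isHomogeneous k f).1 hf
  rw [P.as_sum, map_sum]
  refine Submodule.sum_mem _ fun m hm => ?_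
  have hdeg : k = m 0 + m 1 := by
    have := hP (MvPolynomial.mem_support_iff.1 hm)
    rw [← this, Finsupp.weight_apply, Finsupp.sum_fintype _ _ (by simp), Fin.sum_univ_two]
    simp
  rw [MvPolynomial.aeval_monomial, ← Algebra.smul_def]
  refine Submodule.smul_mem _ _ (Submodule.subset_span ⟨⟨m 1, by omega⟩, ?_⟩)
  rw [Finsupp.prod_fintype _ _ (by simp), Fin.prod_univ_two]
  have : k - m 1 = m 0 := by omega
  simp [this]

/-- The basis of the space of forms of weight `2k` by monomials in `E24` and `Delta4`. -/
lemma exists_basis_monomials (k : ℕ) :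
    ∃ b : Module.Basis (Fin (k + 1)) ℂ (modularFormSpace 4 (2 * (k : ℤ))),
      ∀ i, (b i : ℍ → ℂ) = E24 ^ (k - i : ℕ) * Delta4 ^ (i : ℕ) := by
  have hmem (i : Fin (k + 1)) :
      E24 ^ (k - i : ℕ) * Delta4 ^ (i : ℕ) ∈ modularFormSpace 4 (2 * (k : ℤ)) := by
    have := monomial_mem (k - i) i
    rwa [show k - (i : ℕ) + i = k by omega] at this
  let v : Fin (k + 1) → modularFormSpace 4 (2 * (k : ℤ)) := fun i => ⟨_, hmem i⟩
  have hli : LinearIndependent ℂ v :=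
    LinearIndependent.of_comp (Submodule.subtype _) (linearIndependent_monomials k)
  refine ⟨Module.Basis.mk hli ?_, fun i => by rw [Module.Basis.mk_apply]⟩
  rintro ⟨f, hf⟩ -
  have h := span_monomials k hf
  have hv : (fun i : Fin (k + 1) => E24 ^ (k - i : ℕ) * Delta4 ^ (i : ℕ)) =
      Submodule.subtype (modularFormSpace 4 (2 * (k : ℤ))) ∘ v := rfl
  rw [hv, Set.range_comp, ← Submodule.map_span] at h
  obtain ⟨g, hg, rfl⟩ := h
  exact hg

/-! ### Triangularity of the `q`-expansions, and the final form of the bases and of the direct sum.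
-/

lemma qExpansion_mul_of_mem {N : ℕ} [NeZero N] {j k : ℤ} {f g : ℍ → ℂ}
    (hf : f ∈ modularFormSpace N j) (hg : g ∈ modularFormSpace N k) :
    qExpansion 1 (f * g) = qExpansion 1 f * qExpansion 1 g :=
  qExpansion_mul (analyticAt_cuspFunction_of_mem hf) (analyticAt_cuspFunction_of_mem hg)

lemma qExpansion_pow_of_mem {N : ℕ} [NeZero N] {k : ℤ} {f : ℍ → ℂ}
    (hf : f ∈ modularFormSpace N k) (n : ℕ) :
    qExpansion 1 (f ^ n) = qExpansion 1 f ^ n := by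
  induction n with
  | zero => rw [pow_zero, pow_zero, qExpansion_one]
  | succ n ih =>
    rw [pow_succ, pow_succ, qExpansion_mul_of_mem (pow_mem_modularFormSpace hf n) hf, ih]

/-- The `q`-expansion of `E24 ^ a * Delta4 ^ b` is `q ^ b` times a series with constant
coefficient `1`. -/
lemma exists_qExpansion_monomial_eq (a b : ℕ) : ∃ U : PowerSeries ℂ,
    U.constantCoeff = 1 ∧ qExpansion 1 (E24 ^ a * Delta4 ^ b) = PowerSeries.X ^ b * U := by
  have hE : (qExpansion 1 E24).constantCoeff = 1 := by
    rw [← PowerSeries.coeff_zero_eq_constantCoeff_apply]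
    exact coeff_zero_qExpansion_of_tendsto E24_mem tendsto_E24
  obtain ⟨V, hV⟩ : PowerSeries.X ∣ qExpansion 1 Delta4 := by
    rw [PowerSeries.X_dvd_iff, ← PowerSeries.coeff_zero_eq_constantCoeff_apply]
    exact coeff_zero_qExpansion_of_tendsto Delta4_mem tendsto_Delta4
  have hV1 : V.constantCoeff = 1 := by
    have h := coeff_one_qExpansion_of_tendsto Delta4_mem tendsto_Delta4 tendsto_Delta4_div
    rwa [hV, ← zero_add 1, PowerSeries.coeff_succ_X_mul,
      PowerSeries.coeff_zero_eq_constantCoeff_apply] at h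
  refine ⟨qExpansion 1 E24 ^ a * V ^ b, by simp [hE, hV1], ?_⟩
  rw [qExpansion_mul_of_mem (pow_mem_modularFormSpace E24_mem a)
    (pow_mem_modularFormSpace Delta4_mem b), qExpansion_pow_of_mem E24_mem,
    qExpansion_pow_of_mem Delta4_mem, hV]
  ring

lemma coeff_qExpansion_monomial (a b : ℕ) :
    (qExpansion 1 (E24 ^ a * Delta4 ^ b)).coeff b = 1 := by
  obtain ⟨U, hU, h⟩ := exists_qExpansion_monomial_eq a b
  rw [h, PowerSeries.coeff_X_pow_mul', if_pos le_rfl, Nat.sub_self,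
    PowerSeries.coeff_zero_eq_constantCoeff_apply, hU]

lemma order_qExpansion_monomial (a b : ℕ) :
    (qExpansion 1 (E24 ^ a * Delta4 ^ b)).order = b := by
  refine PowerSeries.order_eq_nat.2 ⟨by simp [coeff_qExpansion_monomial], fun i hi => ?_⟩
  obtain ⟨U, -, h⟩ := exists_qExpansion_monomial_eq a b
  rw [h, PowerSeries.coeff_X_pow_mul', if_neg hi.not_ge]

lemma exists_basis_weight_two : ∃ b : Module.Basis (Fin 2) ℂ (modularFormSpace 4 2),
    (b 0 : ℍ → ℂ) = E24 ∧ (b 1 : ℍ → ℂ) = Delta4 := by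
  obtain ⟨b, hb⟩ := exists_basis_monomials 1
  exact ⟨b, by simpa using hb 0, by simpa using hb 1⟩

lemma exists_basis_antidiagonal (k : ℕ) :
    ∃ b : Module.Basis (Finset.HasAntidiagonal.antidiagonal k) ℂ
      (modularFormSpace 4 (2 * (k : ℤ))),
      ∀ p : Finset.HasAntidiagonal.antidiagonal k,
        (b p : ℍ → ℂ) = E24 ^ p.1.1 * Delta4 ^ p.1.2 := by
  obtain ⟨b, hb⟩ := exists_basis_monomials k
  -- The swap is needed because `antidiagonalEquivFin` records the first coordinate, whereas `b` is
  -- indexed by the exponent of `Delta4`, the second one.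
  refine ⟨b.reindex ((Equiv.subtypeEquiv (Equiv.prodComm ℕ ℕ) fun p => ?_).trans
    (Finset.Nat.antidiagonalEquivFin k)).symm, fun p => ?_⟩
  · simp [add_comm]
  · rw [Module.Basis.reindex_apply, hb]
    have hp := Finset.HasAntidiagonal.mem_antidiagonal.1 p.2
    simp [← hp]

/-- Limits at `i∞` separate the summands: `c • E24 ^ k` tends to `c`, while every multiple of
`Delta4` by a form tends to 0. -/
lemma disjoint_span_pow_map_Delta4 (k : ℕ) :
    Disjoint (Submodule.span ℂ {E24 ^ k})
      ((modularFormSpace 4 (2 * (k : ℤ) - 2)).map (LinearMap.mulLeft ℂ Delta4)) := by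
  rw [Submodule.disjoint_def]
  intro f hf hf'
  obtain ⟨c, rfl⟩ := Submodule.mem_span_singleton.1 hf
  obtain ⟨g, hg, h⟩ := hf'
  have h1 : Tendsto (c • E24 ^ k) atImInfty (𝓝 (c * 1)) := (tendsto_E24_pow k).const_mul c
  have h2 := tendsto_Delta4.mul (tendsto_cuspFunction_of_mem hg)
  have h3 : (fun τ => Delta4 τ * g τ) = c • E24 ^ k := h
  rw [h3, zero_mul] at h2
  have hc := tendsto_nhds_unique h1 h2
  rw [mul_one] at hc
  rw [hc, zero_smul]

lemma modularFormSpace_eq_sup (k : ℕ) :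
    modularFormSpace 4 (2 * (k : ℤ)) = Submodule.span ℂ {E24 ^ k} ⊔
      (modularFormSpace 4 (2 * (k : ℤ) - 2)).map (LinearMap.mulLeft ℂ Delta4) := by
  refine le_antisymm (fun f hf => ?_) (sup_le ?_ ?_)
  · obtain ⟨c, g, hg, rfl⟩ := exists_eq_add_Delta4_mul hf
    exact Submodule.add_mem_sup (Submodule.smul_mem _ c (Submodule.mem_span_singleton_self _))
      ⟨g, hg, rfl⟩
  · rw [Submodule.span_singleton_le_iff_mem]
    exact pow_mem_modularFormSpace E24_mem k
  · rintro _ ⟨g, hg, rfl⟩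
    have h := mul_mem_modularFormSpace Delta4_mem hg
    rwa [add_sub_cancel] at h

end LevelFour

theorem mainTheorem3 :
    -- the two forms as eta quotients and as values of the renormalized Weierstrass function
    (∀ τ : UpperHalfPlane, LevelFour.E24 τ =
      ModularForm.eta (τ : ℂ) ^ 8 / ModularForm.eta (2 * (τ : ℂ)) ^ 4) ∧
    (∀ τ : UpperHalfPlane, LevelFour.Delta4 τ =
      -(1 / 16) * LevelFour.wpTilde (1 / 2) (2 * (τ : ℂ))) ∧
    -- they have no zero on the upper half plane (modular units)
    (∀ τ : UpperHalfPlane, LevelFour.E24 τ ≠ 0 ∧ LevelFour.Delta4 τ ≠ 0) ∧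
    -- they form a basis of the space of weight 2
    (∃ b : Module.Basis (Fin 2) ℂ (LevelFour.modularFormSpace 4 2),
      (b 0 : UpperHalfPlane → ℂ) = LevelFour.E24 ∧
      (b 1 : UpperHalfPlane → ℂ) = LevelFour.Delta4) ∧
    -- internal direct sum decomposition in weight `2k`, `k ≥ 2`
    (∀ k : ℕ, 2 ≤ k →
      Disjoint (Submodule.span ℂ {LevelFour.E24 ^ k})
        ((LevelFour.modularFormSpace 4 (2 * (k : ℤ) - 2)).map
          (LinearMap.mulLeft ℂ LevelFour.Delta4)) ∧
      LevelFour.modularFormSpace 4 (2 * (k : ℤ)) =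
        Submodule.span ℂ {LevelFour.E24 ^ k} ⊔
          (LevelFour.modularFormSpace 4 (2 * (k : ℤ) - 2)).map
            (LinearMap.mulLeft ℂ LevelFour.Delta4)) ∧
    -- the forms of weight `2k` are exactly the homogeneous polynomials of degree `k`
    (∀ k : ℕ, 1 ≤ k → ∀ f : UpperHalfPlane → ℂ,
      f ∈ LevelFour.modularFormSpace 4 (2 * (k : ℤ)) ↔
        ∃ P : MvPolynomial (Fin 2) ℂ, P.IsHomogeneous k ∧
          f = MvPolynomial.aeval ![LevelFour.E24, LevelFour.Delta4] P) ∧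
    -- the monomials of degree `k` form a basis of the space of weight `2k`
    (∀ k : ℕ, 1 ≤ k →
      ∃ b : Module.Basis (Finset.HasAntidiagonal.antidiagonal k) ℂ (LevelFour.modularFormSpace 4 (2 * (k : ℤ))),
        ∀ p : Finset.HasAntidiagonal.antidiagonal k, (b p : UpperHalfPlane → ℂ) =
          LevelFour.E24 ^ p.1.1 * LevelFour.Delta4 ^ p.1.2) ∧
    -- this basis is unitary upper triangular: the `q`-expansion of `E^a Δ^b` is `q^b + O(q^(b+1))`
    (∀ a b : ℕ,
      (UpperHalfPlane.qExpansion 1 (LevelFour.E24 ^ a * LevelFour.Delta4 ^ b)).order = (b : ℕ∞) ∧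
      (UpperHalfPlane.qExpansion 1 (LevelFour.E24 ^ a * LevelFour.Delta4 ^ b)).coeff b = 1) := by
  refine ⟨fun τ => ?_, fun τ => ?_, fun τ => ⟨LevelFour.E24_ne_zero τ, LevelFour.Delta4_ne_zero τ⟩,
    LevelFour.exists_basis_weight_two,
    fun k _ => ⟨LevelFour.disjoint_span_pow_map_Delta4 k, LevelFour.modularFormSpace_eq_sup k⟩,
    fun k _ => LevelFour.mem_iff_exists_isHomogeneous k,
    fun k _ => LevelFour.exists_basis_antidiagonal k,
    fun a b => ⟨LevelFour.order_qExpansion_monomial a b, LevelFour.coeff_qExpansion_monomial a b⟩⟩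
  · rw [LevelFour.E24_eq_e13, LevelFour.e13_dbl_eq, LevelFour.coe_dbl]
  · rw [LevelFour.Delta4_eq_e23, ← LevelFour.wpTilde_one_half, LevelFour.coe_dbl]
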